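/- Let $K$ be an algebraically closed field (of arbitrary characteristic), and let $G$ be a linear algebraic group over $K$, that is, a subgroup of $\mathrm{SL}_n(K)$ for some $n$ that is closed in the Zariski topology of $M_n(K)=K^{n^2}$. The dimension of $G$ is the maximum, over the irreducible components $Z$ of $G$, of the Krull dimension of the coordinate ring $K[x_{11},\dots,x_{nn}]/J(Z)$, where $J(Z)$ is the ideal of all polynomials vanishing on $Z$. Suppose that $G$ is connected in the Zariski topology. If $\dim G<3$, then $G$ is soluble. If $\dim G=1$, then $G$ is abelian. -/

import Mathlib

namespace LinAlgGrp

open MvPolynomial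

/-- The Zariski topology on the affine space `K^σ`: the closed sets are the sets `V(I)` of common
zeros of the ideals `I` of the polynomial ring. -/
abbrev zariskiTopology (σ K : Type*) [Field K] : TopologicalSpace (σ → K) :=
  TopologicalSpace.ofClosed {Z | ∃ I : Ideal (MvPolynomial σ K), Z = zeroLocus K I}
    ⟨⊤, zeroLocus_top.symm⟩
    (by
      intro A hA
      refine ⟨⨆ I ∈ {I : Ideal (MvPolynomial σ K) | zeroLocus K I ∈ A}, I, ?_⟩
      refine Set.Subset.antisymm ?_ ?_
      · intro x hx
        have key : (⨆ I ∈ {I : Ideal (MvPolynomial σ K) | zeroLocus K I ∈ A}, I) ≤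
            vanishingIdeal K {x} := by
          refine iSup₂_le fun I hI p hp => ?_
          rw [mem_vanishingIdeal_iff]
          rintro y rfl
          exact hx _ hI p hp
        intro p hp
        exact mem_vanishingIdeal_iff.1 (key hp) x rfl
      · intro x hx Z hZ
        obtain ⟨I, rfl⟩ := hA hZ
        intro p hp
        refine hx p ?_
        have hle : I ≤ ⨆ I ∈ {I : Ideal (MvPolynomial σ K) | zeroLocus K I ∈ A}, I :=
          le_iSup₂_of_le I hZ le_rfl
        exact hle hp)
    (by
      rintro _ ⟨I, rfl⟩ _ ⟨J, rfl⟩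
      refine ⟨I * J, Set.Subset.antisymm ?_ ?_⟩
      · rintro x (hx | hx)
        · exact zeroLocus_anti_mono Ideal.mul_le_left hx
        · exact zeroLocus_anti_mono Ideal.mul_le_right hx
      · intro x hx
        by_contra hcon
        rw [Set.mem_union, not_or] at hcon
        obtain ⟨h₁, h₂⟩ := hcon
        rw [mem_zeroLocus_iff] at h₁ h₂
        push Not at h₁ h₂
        obtain ⟨p, hp, hpx⟩ := h₁
        obtain ⟨q, hq, hqx⟩ := h₂
        have h := hx (p * q) (Ideal.mul_mem_mul hp hq)
        rw [map_mul] at h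
        exact (mul_ne_zero hpx hqx) h)

/-- The coordinate ring `K[x] / J(W)` of a subset `W` of affine space, where `J(W)` is the ideal of
all polynomials that vanish on `W`. -/
abbrev CoordinateRing {σ K : Type*} [Field K] (W : Set (σ → K)) : Type _ :=
  MvPolynomial σ K ⧸ vanishingIdeal K W

/-- `Z` is an irreducible component of `W`: a maximal irreducible subset of `W`. (If `W` is closed
then such a `Z` is closed.) -/
def IsIrredComponent {σ K : Type*} [Field K] (W Z : Set (σ → K)) : Prop :=
  Maximal (fun Y : Set (σ → K) => Y ⊆ W ∧ @IsIrreducible _ (zariskiTopology σ K) Y) Z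

/-- The dimension of an affine variety: the supremum, over its irreducible components, of the Krull
dimension of their coordinate rings. -/
noncomputable def dim {σ K : Type*} [Field K] (W : Set (σ → K)) : WithBot ℕ∞ :=
  ⨆ Z : {Z : Set (σ → K) // IsIrredComponent W Z}, ringKrullDim (CoordinateRing Z.1)

/-- A subgroup of `SL_n(K)` as a subset of the affine space `K^(n × n)` of all matrices. -/
def points {K : Type*} [Field K] {n : ℕ} (G : Subgroup (Matrix.SpecialLinearGroup (Fin n) K)) :
    Set (Fin n × Fin n → K) :=
  {x | ∃ g ∈ G, ∀ i j, x (i, j) = (g : Matrix (Fin n) (Fin n) K) i j}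

/-- A linear algebraic group over `K`: a Zariski-closed subgroup of `SL_n(K)`. -/
def IsLinearAlgebraicGroup {K : Type*} [Field K] {n : ℕ}
    (G : Subgroup (Matrix.SpecialLinearGroup (Fin n) K)) : Prop :=
  @IsClosed _ (zariskiTopology (Fin n × Fin n) K) (points G)

/-- Connectedness of a subgroup of `SL_n(K)` in the Zariski topology. -/
def IsZariskiConnected {K : Type*} [Field K] {n : ℕ}
    (G : Subgroup (Matrix.SpecialLinearGroup (Fin n) K)) : Prop :=
  @IsConnected _ (zariskiTopology (Fin n × Fin n) K) (points G)

end LinAlgGrp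

/-! Everything happens in the algebra `R` of regular functions on `G`, a domain because a connected
Noetherian group is irreducible. For `x` in `G`, consider the class map `g ↦ g x g⁻¹`. If the class
is dense, all elements share the characteristic polynomial of `1`, so `G` is unipotent, and
Kolchin's theorem makes it trivial (`eq_one_of_injective_conjPullback`). Otherwise the class map has
image of smaller dimension than `G`. In dimension at most one the image is then a point, so `x` is
central.

In dimension two let `x` be noncentral. Its centralizer, the fibre of the class map over `x`, is
infinite, since a finite fibre would force dimension at most one (`infinite_centralizer`). It
contains an infinite irreducible subgroup `H`, whose function algebra is a proper quotient of `R`;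
so `H` is commutative. Solubility follows from an invariant flag, for which an invariant `U ≠ K^n`
has to be enlarged by one dimension (`exists_larger_invariant`).

Let `v` be a common eigenvector of `H` modulo `U`, let `V` be the space of functions `g ↦ ξ (g v)`
with `ξ ∈ U^⊥`, and let `F` be spanned by the constants and the entries of `g x g⁻¹`. Right
translation by `H` scales `M = V F` by a single character. Ratios of such functions are thus fixed
by infinitely many automorphisms of the function field, and any two with the same denominator in `V`
are algebraically dependent: `M` maps `G` to a projective variety of dimension at most one, with
homogeneous coordinate ring `⨁ Mᵐ Xᵐ`. Left translation permutes the finitely many points where `V`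
vanishes. If there is such a point, it defines a hyperplane of `V` (`colonSubmodule`), invariant
because `G` is irreducible, and dually an enlargement of `U`. If there is none, then `M^(N+1) ⊆ V
M^N` for some `N`, so the elements of `F` are integral over `K`, hence constant, and `x` is central,
a contradiction. This is `exists_algebraMap_eq_of_forall_hyperplane`; it plays the role of Borel's
fixed point theorem without quotient varieties. -/

open MvPolynomial

universe u

/-! ### Transcendence degree and automorphisms of function fields -/

/-- A finitely generated domain over a field has transcendence degree at most its Krull
dimension. -/
theorem trdeg_le_of_ringKrullDim_le {K R : Type u} [Field K] [CommRing R] [IsDomain R]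
    [Algebra K R] [Algebra.FiniteType K R] {d : ℕ} (hdim : ringKrullDim R ≤ d) :
    Algebra.trdeg K R ≤ d := by
  obtain ⟨s, g, hinj, hint⟩ := exists_integral_inj_algHom_of_fg K R
  let _ : Algebra (MvPolynomial (Fin s) K) R := g.toRingHom.toAlgebra
  have : IsScalarTower K (MvPolynomial (Fin s) K) R :=
    IsScalarTower.of_algebraMap_eq fun x => (g.commutes x).symm
  have : Algebra.IsIntegral (MvPolynomial (Fin s) K) R := ⟨hint⟩
  have : FaithfulSMul (MvPolynomial (Fin s) K) R :=
    (faithfulSMul_iff_algebraMap_injective _ _).2 hinj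
  have htr := trdeg_add_eq K (MvPolynomial (Fin s) K) (A := R)
  rw [MvPolynomial.trdeg_of_isDomain, trdeg_eq_zero, add_zero] at htr
  rw [← htr]
  have hs : (s : WithBot ℕ∞) ≤ d := by
    refine le_trans ?_ hdim
    have h := MvPolynomial.ringKrullDim_of_isNoetherianRing (R := K) (ι := Fin s)
    rw [ringKrullDim_eq_zero_of_field, zero_add, Nat.card_fin] at h
    rw [← h]
    -- Lying over for the bottom prime and going up lift each chain of primes to `R`.
    refine iSup_le fun l => ?_
    obtain ⟨P, hP, hlo⟩ : ∃ P : Ideal R, P.IsPrime ∧ P.LiesOver l.head.asIdeal := by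
      obtain ⟨P, -, hP, hc⟩ := Ideal.exists_ideal_over_prime_of_isIntegral
        (S := R) l.head.asIdeal ⊥ (by
          rw [← RingHom.ker_eq_comap_bot,
            (RingHom.injective_iff_ker_eq_bot (algebraMap (MvPolynomial (Fin s) K) R)).1 hinj]
          exact bot_le)
      exact ⟨P, hP, ⟨hc.symm⟩⟩
    obtain ⟨L, hL, -⟩ := Ideal.exists_ltSeries_of_hasGoingUp l P
    rw [← hL]
    exact le_iSup (fun p : LTSeries (PrimeSpectrum R) => (p.length : WithBot ℕ∞)) L
  have hs' : s ≤ d := by exact_mod_cast hs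
  simpa using hs'

theorem exists_algHom_fractionRing {K R : Type*} [Field K] [CommRing R] [IsDomain R] [Algebra K R]
    (σ : R ≃ₐ[K] R) : ∃ τ : FractionRing R →ₐ[K] FractionRing R,
      ∀ r, τ (algebraMap R _ r) = algebraMap R _ (σ r) := by
  have h : Function.Injective ((IsScalarTower.toAlgHom K R (FractionRing R)).comp
      (σ : R →ₐ[K] R)) :=
    (IsFractionRing.injective R (FractionRing R)).comp σ.injective
  exact ⟨IsFractionRing.liftAlgHom h, fun r => IsFractionRing.lift_algebraMap h r⟩

/-- If infinitely many automorphisms of a domain of dimension at most two multiply `η`, `ζ`, `u` by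
the same factors, then `η / u` and `ζ / u` are algebraically dependent. -/
theorem exists_aeval_div_eq_zero {K R : Type u} [Field K] [CommRing R] [IsDomain R]
    [Algebra K R] [Algebra.FiniteType K R] (hdim : ringKrullDim R ≤ 2) {ι : Type*} [Infinite ι]
    (σ : ι → R ≃ₐ[K] R) (hσ : Function.Injective σ) {η ζ u : R} (hu : u ≠ 0)
    (hη : ∀ i, σ i η * u = η * σ i u) (hζ : ∀ i, σ i ζ * u = ζ * σ i u) :
    ∃ p : MvPolynomial (Fin 2) K, p ≠ 0 ∧
      aeval ![algebraMap R (FractionRing R) η / algebraMap R (FractionRing R) u,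
        algebraMap R (FractionRing R) ζ / algebraMap R (FractionRing R) u] p = 0 := by
  set L := FractionRing R
  set y : Fin 2 → L := ![algebraMap R L η / algebraMap R L u,
    algebraMap R L ζ / algebraMap R L u] with hy
  by_contra! hcon
  have hind : AlgebraicIndependent K y := by
    rw [algebraicIndependent_iff]
    exact fun p hp => by_contra fun h => hcon p h hp
  have hinjL : Function.Injective (algebraMap R L) := IsFractionRing.injective R L
  have htr : Algebra.trdeg K L ≤ 2 := by
    have : Algebra.IsAlgebraic R L := IsLocalization.isAlgebraic _ (nonZeroDivisors R)
    have h := trdeg_add_eq K R (A := L)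
    rw [trdeg_eq_zero (R := R), add_zero] at h
    rw [← h]
    exact_mod_cast trdeg_le_of_ringKrullDim_le (d := 2) (by exact_mod_cast hdim)
  -- Two independent elements exhaust the transcendence degree, so `L` is finite over `E = K(y)` and
  -- has only finitely many `E`-endomorphisms; but every `σ i` induces one.
  have hbasis : IsTranscendenceBasis K y :=
    hind.isTranscendenceBasis_of_lift_trdeg_le_of_finite (by simpa using htr)
  let E : IntermediateField K L := IntermediateField.adjoin K (Set.range y)
  have : Algebra.IsAlgebraic E L := hbasis.isAlgebraic_field
  have : Algebra.EssFiniteType R L := Algebra.EssFiniteType.of_isLocalization _ (nonZeroDivisors R)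
  have : Algebra.EssFiniteType K L := Algebra.EssFiniteType.comp K R L
  have : Algebra.EssFiniteType E L := Algebra.EssFiniteType.of_comp K E L
  have : FiniteDimensional E L := Algebra.finite_of_essFiniteType_of_isAlgebraic
  choose τ hτ using fun i => exists_algHom_fractionRing (σ i)
  have hquot : ∀ i, ∀ w, σ i w * u = w * σ i u → τ i (algebraMap R L w / algebraMap R L u)
      = algebraMap R L w / algebraMap R L u := by
    intro i w hw
    have h1 : algebraMap R L u ≠ 0 := by simpa using hu
    have h2 : algebraMap R L (σ i u) ≠ 0 := by simpa using hu
    rw [map_div₀, hτ, hτ, div_eq_div_iff h2 h1, ← map_mul, hw, map_mul]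
  have hfix : ∀ i, (τ i).comp E.val = E.val := by
    intro i
    apply IntermediateField.algHom_ext_of_eq_adjoin K (S := E) (s := Set.range y) rfl
    rintro _ ⟨j, rfl⟩
    fin_cases j
    · exact hquot i η (hη i)
    · exact hquot i ζ (hζ i)
  let τ' : ι → (L →ₐ[E] L) := fun i =>
    { τ i with commutes' := fun r => DFunLike.congr_fun (hfix i) r }
  have hτ' : Function.Injective τ' := by
    intro i j hij
    apply hσ
    ext r
    apply hinjL
    rw [← hτ, ← hτ]
    exact DFunLike.congr_fun hij (algebraMap R L r)
  exact (Finite.of_injective τ' hτ').false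

/-! ### Binary forms over an algebraically closed field -/

theorem aeval_mul_mul_of_isHomogeneous {K A : Type*} [CommRing K] [CommRing A]
    [Algebra K A] {p : MvPolynomial (Fin 2) K} {d : ℕ} (hp : p.IsHomogeneous d) (a b c : A) :
    aeval ![c * a, c * b] p = c ^ d * aeval ![a, b] p := by
  rw [aeval_def, aeval_def, eval₂_eq', eval₂_eq', Finset.mul_sum]
  refine Finset.sum_congr rfl fun s hs => ?_
  have hs' : s 0 + s 1 = d := by
    have := hp (mem_support_iff.1 hs)
    rwa [Finsupp.weight_apply, Finsupp.sum_fintype _ _ (by simp), Fin.sum_univ_two,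
      Pi.one_apply, Pi.one_apply, smul_eq_mul, smul_eq_mul, mul_one, mul_one] at this
  simp only [Fin.prod_univ_two, Matrix.cons_val_zero, Matrix.cons_val_one, ← hs', mul_pow, pow_add]
  ring

theorem IsIntegral.exists_algebraMap_eq {K A : Type*} [Field K] [IsAlgClosed K] [CommRing A]
    [IsDomain A] [Algebra K A] {x : A} (hx : IsIntegral K x) : ∃ c : K, algebraMap K A c = x :=
  minpoly.mem_range_of_degree_eq_one K x
    (IsAlgClosed.degree_eq_one_of_irreducible K (minpoly.irreducible hx))

/-- A nonzero binary form over an algebraically closed field is a product of linear forms, so its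
zeros in a domain are proportional over the field. -/
theorem exists_eq_smul_of_aeval_eq_zero {K D : Type*} [Field K] [IsAlgClosed K]
    [CommRing D] [IsDomain D] [Algebra K D] {p : MvPolynomial (Fin 2) K} (hp : p ≠ 0) {d : ℕ}
    (hpd : p.IsHomogeneous d) {y z : D} (h : aeval ![y, z] p = 0) (hz : z ≠ 0) :
    ∃ c : K, y = c • z := by
  let q : Polynomial K := aeval ![Polynomial.X, 1] p
  have hq : q ≠ 0 := by
    intro hq0
    apply hp
    -- The factor `X 1` disposes of the points at which dehomogenization is impossible.
    have key : p * X 1 = 0 := by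
      apply MvPolynomial.funext
      intro x
      rw [map_mul, eval_X, map_zero]
      by_cases hx : x 1 = 0
      · rw [hx, mul_zero]
      have h1 : eval x p = aeval ![x 1 * (x 0 / x 1), x 1 * 1] p := by
        rw [mul_div_cancel₀ _ hx, mul_one, ← coe_aeval_eq_eval, RingHom.coe_coe]
        congr 2
        ext i
        fin_cases i <;> rfl
      have h2 : aeval ![x 0 / x 1, 1] p = Polynomial.aeval (x 0 / x 1) q := by
        rw [← AlgHom.comp_apply, comp_aeval]
        congr 2
        ext i
        fin_cases i <;> simp
      rw [h1, aeval_mul_mul_of_isHomogeneous hpd, h2, hq0, map_zero, mul_zero, zero_mul]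
    exact (mul_eq_zero.1 key).resolve_right (X_ne_zero 1)
  set L := FractionRing D
  have hinjL : Function.Injective (algebraMap D L) := IsFractionRing.injective D L
  have hz' : algebraMap D L z ≠ 0 := by simpa using hz
  have hw : Polynomial.aeval (algebraMap D L y / algebraMap D L z) q = 0 := by
    have h2 : Polynomial.aeval (algebraMap D L y / algebraMap D L z) q
        = aeval ![algebraMap D L y / algebraMap D L z, 1] p := by
      rw [← AlgHom.comp_apply, comp_aeval]
      congr 2
      ext i
      fin_cases i <;> simp
    have h3 := aeval_mul_mul_of_isHomogeneous hpd (algebraMap D L y / algebraMap D L z) 1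
      (algebraMap D L z)
    have h4 : aeval ![algebraMap D L y, algebraMap D L z] p = 0 := by
      have : aeval ![algebraMap D L y, algebraMap D L z] p
          = (Algebra.ofId D L).restrictScalars K (aeval ![y, z] p) := by
        rw [← AlgHom.comp_apply, comp_aeval]
        congr 2
        ext i
        fin_cases i <;> rfl
      rw [this, h, map_zero]
    rw [mul_div_cancel₀ _ hz', mul_one, h4] at h3
    rw [h2]
    exact (mul_eq_zero.1 h3.symm).resolve_left (pow_ne_zero _ hz')
  have halg : IsAlgebraic K (algebraMap D L y / algebraMap D L z) := ⟨q, hq, hw⟩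
  obtain ⟨c, hc⟩ := halg.isIntegral.exists_algebraMap_eq
  refine ⟨c, hinjL ?_⟩
  rw [Algebra.smul_def, map_mul, ← IsScalarTower.algebraMap_apply, hc, div_mul_cancel₀ _ hz']

/-! ### Homogenization in two variables -/

section DegreeHomogenization

variable {K : Type*} [Field K]

/-- The value at `(a, b, c)` of the degree `d` homogenization of `p`. -/
noncomputable def homogenizationEval {A : Type*} [CommRing A] [Algebra K A]
    (p : MvPolynomial (Fin 2) K) (d : ℕ) (a b c : A) : A :=
  ∑ m ∈ p.support, algebraMap K A (coeff m p) * (a ^ m 0 * b ^ m 1 * c ^ (d - (m 0 + m 1)))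

theorem map_homogenizationEval {A B : Type*} [CommRing A] [Algebra K A] [CommRing B] [Algebra K B]
    (φ : A →ₐ[K] B) (p : MvPolynomial (Fin 2) K) (d : ℕ) (a b c : A) :
    φ (homogenizationEval p d a b c) = homogenizationEval p d (φ a) (φ b) (φ c) := by
  simp [homogenizationEval]

theorem degree_fin_two (m : Fin 2 →₀ ℕ) : m.degree = m 0 + m 1 := by
  rw [Finsupp.degree_eq_sum, Fin.sum_univ_two]

theorem homogenizationEval_mul {A : Type*} [CommRing A] [Algebra K A]
    (p : MvPolynomial (Fin 2) K) (x y c : A) :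
    homogenizationEval p p.totalDegree (x * c) (y * c) c = c ^ p.totalDegree * aeval ![x, y] p := by
  rw [aeval_def, eval₂_eq', Finset.mul_sum, homogenizationEval]
  refine Finset.sum_congr rfl fun m hm => ?_
  have h : m 0 + m 1 ≤ p.totalDegree := by
    have := le_totalDegree hm
    rwa [show (m.sum fun _ e => e) = m.degree from rfl, degree_fin_two] at this
  simp only [Fin.prod_univ_two, Matrix.cons_val_zero, Matrix.cons_val_one]
  rw [← Nat.sub_add_cancel h, pow_add, Nat.add_sub_cancel, pow_add]
  ring

/-- Only terms of top degree carry the zeroth power of the third argument. This is how a relation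
becomes a binary form modulo a prime that contains that argument. -/
theorem homogenizationEval_zero {A : Type*} [CommRing A] [Algebra K A]
    (p : MvPolynomial (Fin 2) K) (x y : A) :
    homogenizationEval p p.totalDegree x y 0
      = aeval ![x, y] (homogeneousComponent p.totalDegree p) := by
  rw [homogeneousComponent_apply, map_sum, homogenizationEval, Finset.sum_filter]
  refine Finset.sum_congr rfl fun m hm => ?_
  have h : m 0 + m 1 ≤ p.totalDegree := by
    have := le_totalDegree hm
    rwa [show (m.sum fun _ e => e) = m.degree from rfl, degree_fin_two] at this
  rw [degree_fin_two]
  split_ifs with h'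
  · rw [h', Nat.sub_self, pow_zero, mul_one, aeval_monomial,
      Finsupp.prod_fintype _ _ (by simp), Fin.prod_univ_two]
    rfl
  · rw [zero_pow (by omega), mul_zero, mul_zero]

theorem homogeneousComponent_totalDegree_ne_zero {p : MvPolynomial (Fin 2) K} (hp : p ≠ 0) :
    homogeneousComponent p.totalDegree p ≠ 0 := by
  obtain ⟨m, hm, hd⟩ := Finset.exists_mem_eq_sup p.support (support_nonempty.2 hp)
    (fun s => s.sum fun _ e => e)
  intro h
  have := congrArg (coeff m) h
  rw [coeff_homogeneousComponent, if_pos, coeff_zero] at this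
  · exact mem_support_iff.1 hm this
  · exact hd.symm

end DegreeHomogenization

/-! ### The homogeneous coordinate ring of a space of functions -/

section LinearRees

variable {K R : Type u} [Field K] [CommRing R] [Algebra K R] (M V : Submodule K R)

/-- The graded algebra `⨁ Mᵐ Xᵐ` attached to a subspace `M` of an algebra. -/
noncomputable abbrev linearRees : Subalgebra K (Polynomial R) :=
  Algebra.adjoin K (Polynomial.monomial 1 '' (M : Set R))

theorem coeff_mem_of_mem_linearRees {s : Polynomial R} (hs : s ∈ linearRees M) (m : ℕ) :
    s.coeff m ∈ M ^ m := by
  induction hs using Algebra.adjoin_induction generalizing m with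
  | mem x hx =>
    obtain ⟨f, hf, rfl⟩ := hx
    rw [Polynomial.coeff_monomial]
    split_ifs with h
    · rwa [← h, pow_one]
    · exact zero_mem _
  | algebraMap r =>
    rw [Polynomial.algebraMap_apply, Polynomial.coeff_C]
    split_ifs with h
    · rw [h, pow_zero]
      exact Submodule.algebraMap_mem r
    · exact zero_mem _
  | add x y _ _ hx hy =>
    rw [Polynomial.coeff_add]
    exact add_mem (hx m) (hy m)
  | mul x y _ _ hx hy =>
    rw [Polynomial.coeff_mul]
    refine sum_mem fun ij hij => ?_
    rw [← Finset.HasAntidiagonal.mem_antidiagonal.1 hij, pow_add]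
    exact Submodule.mul_mem_mul (hx _) (hy _)

theorem monomial_mem_linearRees {f : R} (hf : f ∈ M) : Polynomial.monomial 1 f ∈ linearRees M :=
  Algebra.subset_adjoin ⟨f, hf, rfl⟩

theorem isNoetherianRing_linearRees (hM : M.FG) : IsNoetherianRing (linearRees M) := by
  obtain ⟨s, hs⟩ := hM
  have h : linearRees M = Algebra.adjoin K (Polynomial.monomial 1 '' (s : Set R)) := by
    refine le_antisymm (Algebra.adjoin_le ?_) (Algebra.adjoin_mono ?_)
    · rintro _ ⟨f, hf, rfl⟩
      have hle : M ≤ (Subalgebra.toSubmodule (Algebra.adjoin K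
          (Polynomial.monomial 1 '' (s : Set R)))).comap
            ((Polynomial.monomial 1 : R →ₗ[R] Polynomial R).restrictScalars K) := by
        rw [← hs, Submodule.span_le]
        exact fun x hx => Algebra.subset_adjoin ⟨x, hx, rfl⟩
      exact hle hf
    · rw [← hs]
      exact Set.image_mono Submodule.subset_span
  have hfg : (linearRees M).FG := by
    rw [h]
    exact Subalgebra.fg_def.2 ⟨_, s.finite_toSet.image _, rfl⟩
  have := (Subalgebra.fg_iff_finiteType _).1 hfg
  exact Algebra.FiniteType.isNoetherianRing K _

/-- The ideal of `linearRees M` generated by the elements `u X` with `u ∈ V`. -/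
noncomputable abbrev linearReesIdeal : Ideal (linearRees M) :=
  Ideal.span {s | ∃ u ∈ V, (s : Polynomial R) = Polynomial.monomial 1 u}

/-- The generators have degree one and coefficients in `V`, and the multipliers of degree `m` have
coefficients in `Mᵐ`. Ideal membership thereby turns into inclusions of subspaces of `R`. -/
theorem coeff_mem_of_mem_linearReesIdeal {s : linearRees M} (hs : s ∈ linearReesIdeal M V) :
    (s : Polynomial R).coeff 0 = 0 ∧ ∀ m, (s : Polynomial R).coeff (m + 1) ∈ V * M ^ m := by
  induction hs using Submodule.span_induction with
  | mem x hx =>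
    obtain ⟨u, hu, hx⟩ := hx
    refine ⟨by rw [hx, Polynomial.coeff_monomial, if_neg one_ne_zero], fun m => ?_⟩
    rw [hx, Polynomial.coeff_monomial]
    split_ifs with h
    · obtain rfl : m = 0 := by omega
      rwa [pow_zero, mul_one]
    · exact zero_mem _
  | zero => exact ⟨rfl, fun m => zero_mem _⟩
  | add x y _ _ hx hy =>
    exact ⟨by rw [AddMemClass.coe_add, Polynomial.coeff_add, hx.1, hy.1, add_zero],
      fun m => add_mem (hx.2 m) (hy.2 m)⟩
  | smul a x _ hx =>
    rw [smul_eq_mul, MulMemClass.coe_mul]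
    refine ⟨by rw [Polynomial.mul_coeff_zero, hx.1, mul_zero], fun m => ?_⟩
    rw [Polynomial.coeff_mul]
    refine sum_mem fun ij hij => ?_
    obtain ⟨i, j⟩ := ij
    have hij' : i + j = m + 1 := Finset.HasAntidiagonal.mem_antidiagonal.1 hij
    cases j with
    | zero =>
      rw [hx.1, mul_zero]
      exact zero_mem _
    | succ j =>
      obtain rfl : m = i + j := by omega
      have := Submodule.mul_mem_mul (coeff_mem_of_mem_linearRees M a.2 i) (hx.2 j)
      rwa [mul_left_comm, ← pow_add] at this

variable {M V} in
theorem exists_mem_pow_of_mem_pow {J : Ideal (linearRees M)}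
    (hJ : ∀ f (hf : f ∈ M), ⟨_, monomial_mem_linearRees M hf⟩ ∈ J) {N : ℕ} {f : R}
    (hf : f ∈ M ^ N) : ∃ s ∈ J ^ N, (s : Polynomial R) = Polynomial.monomial N f := by
  induction hf using Submodule.pow_induction_on_left' with
  | algebraMap r =>
    exact ⟨algebraMap K _ r, by simp, rfl⟩
  | add x y i hx hy ihx ihy =>
    obtain ⟨s, hs, hs'⟩ := ihx
    obtain ⟨t, ht, ht'⟩ := ihy
    exact ⟨s + t, add_mem hs ht, by rw [map_add, ← hs', ← ht']; rfl⟩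
  | mem_mul m hm i x hx ih =>
    obtain ⟨s, hs, hs'⟩ := ih
    refine ⟨⟨_, monomial_mem_linearRees M hm⟩ * s, ?_, ?_⟩
    · rw [pow_succ']
      exact Ideal.mul_mem_mul (hJ m hm) hs
    · rw [MulMemClass.coe_mul, hs', Polynomial.monomial_mul_monomial, add_comm]

end LinearRees

/-! ### Primes at which `V` vanishes -/

section Hyperplanes

variable {K R : Type u} [Field K] [CommRing R] [Algebra K R] (M V F : Submodule K R)

variable {M} in
/-- The ideal `P` contains the element `f X`. -/
def MonomialMem (P : Ideal (linearRees M)) (f : R) : Prop :=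
  ∃ s ∈ P, (s : Polynomial R) = Polynomial.monomial 1 f

variable {M} {P : Ideal (linearRees M)}

theorem MonomialMem.add {f g : R} (hf : MonomialMem P f) (hg : MonomialMem P g) :
    MonomialMem P (f + g) := by
  obtain ⟨s, hs, hs'⟩ := hf
  obtain ⟨t, ht, ht'⟩ := hg
  exact ⟨s + t, add_mem hs ht, by rw [map_add, ← hs', ← ht']; rfl⟩

theorem MonomialMem.smul (c : K) {f : R} (hf : MonomialMem P f) : MonomialMem P (c • f) := by
  obtain ⟨s, hs, hs'⟩ := hf
  refine ⟨c • s, Submodule.smul_of_tower_mem P c hs, ?_⟩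
  rw [← Polynomial.smul_monomial, ← hs']
  rfl

theorem monomialMem_zero : MonomialMem P 0 :=
  ⟨0, zero_mem _, by simp⟩

theorem monomialMem_iff {f : R} (hf : f ∈ M) :
    MonomialMem P f ↔ (⟨_, monomial_mem_linearRees M hf⟩ : linearRees M) ∈ P := by
  constructor
  · rintro ⟨s, hs, hs'⟩
    convert hs
    exact hs'.symm
  · exact fun h => ⟨_, h, rfl⟩

/-- The elements `u` of `V` for which `u F X` lies in `P`. -/
def colonSubmodule (P : Ideal (linearRees M)) : Submodule K R where
  carrier := {u | u ∈ V ∧ ∀ f ∈ F, MonomialMem P (u * f)}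
  add_mem' := fun ha hb => ⟨add_mem ha.1 hb.1, fun f hf => by
    rw [add_mul]; exact (ha.2 f hf).add (hb.2 f hf)⟩
  zero_mem' := ⟨zero_mem _, fun f _ => by rw [zero_mul]; exact monomialMem_zero⟩
  smul_mem' := fun c a ha => ⟨Submodule.smul_mem _ _ ha.1, fun f hf => by
    rw [smul_mul_assoc]; exact (ha.2 f hf).smul c⟩

/-- Over the fraction field, `yX` and `zX` are `y/u` and `z/u` times `uX`, so the value is a power
of `uX` times the given relation. -/
theorem homogenizationEval_monomial_eq_zero [IsDomain R]
    {y z u : R} (hy : y ∈ M) (hz : z ∈ M) (hu : u ∈ M) (hu0 : u ≠ 0) {p : MvPolynomial (Fin 2) K}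
    (hpe : aeval ![algebraMap R (FractionRing R) y / algebraMap R (FractionRing R) u,
        algebraMap R (FractionRing R) z / algebraMap R (FractionRing R) u] p = 0) :
    homogenizationEval p p.totalDegree (⟨_, monomial_mem_linearRees M hy⟩ : linearRees M)
      ⟨_, monomial_mem_linearRees M hz⟩ ⟨_, monomial_mem_linearRees M hu⟩ = 0 := by
  let φ : linearRees M →ₐ[K] Polynomial (FractionRing R) :=
    (Polynomial.mapAlgHom (IsScalarTower.toAlgHom K R (FractionRing R))).comp
      (linearRees M).val
  have hφ : Function.Injective φ :=
    (Polynomial.map_injective _ (IsFractionRing.injective R (FractionRing R))).comp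
      Subtype.val_injective
  apply hφ
  rw [map_homogenizationEval, map_zero]
  have huL : algebraMap R (FractionRing R) u ≠ 0 := by simpa using hu0
  have hmon : ∀ w (hw : w ∈ M), φ ⟨_, monomial_mem_linearRees M hw⟩
      = Polynomial.monomial 1 (algebraMap R (FractionRing R) w) := fun w hw =>
    Polynomial.map_monomial _
  have hval : ∀ w (hw : w ∈ M), φ ⟨_, monomial_mem_linearRees M hw⟩
      = Polynomial.C (algebraMap R (FractionRing R) w / algebraMap R (FractionRing R) u)
        * φ ⟨_, monomial_mem_linearRees M hu⟩ := by
    intro w hw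
    rw [hmon w hw, hmon u hu, Polynomial.C_mul_monomial, div_mul_cancel₀ _ huL]
  rw [hval y hy, hval z hz, homogenizationEval_mul]
  have hC : aeval ![Polynomial.C (algebraMap R (FractionRing R) y /
        algebraMap R (FractionRing R) u), Polynomial.C (algebraMap R (FractionRing R) z /
        algebraMap R (FractionRing R) u)] p = Polynomial.C (aeval ![
        algebraMap R (FractionRing R) y / algebraMap R (FractionRing R) u,
        algebraMap R (FractionRing R) z / algebraMap R (FractionRing R) u] p) := by
    rw [← Polynomial.algebraMap_eq, ← aeval_algebraMap_apply]
    congr 2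
    ext i
    fin_cases i <;> rfl
  rw [hC, hpe, map_zero, mul_zero]

/-- In the domain `S ⧸ P` the class of `U` is zero, so what survives is the nonzero top form of `p`,
a binary form vanishing at the classes of `Y` and `Z`. -/
theorem exists_sub_smul_mem_of_homogenizationEval_eq_zero {S : Type*} [CommRing S] [Algebra K S]
    [IsAlgClosed K] {P : Ideal S} (hP : P.IsPrime) {Y Z U : S} (hU : U ∈ P) (hZ : Z ∉ P)
    {p : MvPolynomial (Fin 2) K} (hp : p ≠ 0)
    (h : homogenizationEval p p.totalDegree Y Z U = 0) : ∃ c : K, Y - c • Z ∈ P := by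
  have hmk : homogenizationEval p p.totalDegree (Ideal.Quotient.mkₐ K P Y)
      (Ideal.Quotient.mkₐ K P Z) (Ideal.Quotient.mkₐ K P U) = 0 :=
    (map_homogenizationEval (Ideal.Quotient.mkₐ K P) p _ Y Z U).symm.trans (by rw [h, map_zero])
  have hU' : Ideal.Quotient.mkₐ K P U = 0 := Ideal.Quotient.eq_zero_iff_mem.2 hU
  have hZ' : Ideal.Quotient.mkₐ K P Z ≠ 0 := fun h => hZ (Ideal.Quotient.eq_zero_iff_mem.1 h)
  rw [hU', homogenizationEval_zero] at hmk
  obtain ⟨c, hc⟩ := exists_eq_smul_of_aeval_eq_zero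
    (homogeneousComponent_totalDegree_ne_zero hp) (homogeneousComponent_isHomogeneous _ _) hmk hZ'
  refine ⟨c, Ideal.Quotient.eq_zero_iff_mem.1 ?_⟩
  change Ideal.Quotient.mkₐ K P (Y - c • Z) = 0
  rw [map_sub, map_smul, hc, sub_self]

/-- If `y / u` and `z / u` are algebraically dependent for some `u X ∈ P`, then `y X` and `z X` are
proportional modulo `P`. -/
theorem exists_monomialMem_sub_smul [IsDomain R] [IsAlgClosed K] (hP : P.IsPrime)
    {y z u : R} (hy : y ∈ M) (hz : z ∈ M) (hu : u ∈ M) (hu0 : u ≠ 0) (huP : MonomialMem P u)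
    (hzP : ¬ MonomialMem P z)
    (hrel : ∃ p : MvPolynomial (Fin 2) K, p ≠ 0 ∧
      aeval ![algebraMap R (FractionRing R) y / algebraMap R (FractionRing R) u,
        algebraMap R (FractionRing R) z / algebraMap R (FractionRing R) u] p = 0) :
    ∃ c : K, MonomialMem P (y - c • z) := by
  obtain ⟨p, hp, hpe⟩ := hrel
  obtain ⟨c, hc⟩ := exists_sub_smul_mem_of_homogenizationEval_eq_zero hP
    ((monomialMem_iff hu).1 huP) (fun h => hzP ((monomialMem_iff hz).2 h)) hp
    (homogenizationEval_monomial_eq_zero hy hz hu hu0 hpe)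
  refine ⟨c, _, hc, ?_⟩
  rw [map_sub, ← Polynomial.smul_monomial]
  rfl

end Hyperplanes

/-! ### The fixed hyperplane argument -/

section FixedHyperplane

variable {K R : Type u} [Field K] [CommRing R] [Algebra K R]

/-- The automorphism of `linearRees M` induced by an automorphism that preserves `M`. -/
noncomputable def linearReesEquiv (M : Submodule K R) (σ : R ≃ₐ[K] R)
    (h : ∀ f, σ f ∈ M ↔ f ∈ M) : linearRees M ≃ₐ[K] linearRees M :=
  ((Polynomial.mapAlgEquiv σ).subalgebraMap (linearRees M)).trans <| Subalgebra.equivOfEq _ _ <| by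
    rw [AlgHom.map_adjoin]
    congr 1
    ext x
    constructor
    · rintro ⟨_, ⟨f, hf, rfl⟩, rfl⟩
      exact ⟨σ f, (h f).2 hf, (Polynomial.map_monomial (σ : R →+* R)).symm⟩
    · rintro ⟨f, hf, rfl⟩
      refine ⟨_, ⟨σ.symm f, (h _).1 (by simpa using hf), rfl⟩, ?_⟩
      exact (Polynomial.map_monomial (σ : R →+* R)).trans (by simp)

theorem coe_linearReesEquiv (M : Submodule K R) (σ : R ≃ₐ[K] R)
    (h : ∀ f, σ f ∈ M ↔ f ∈ M) (s : linearRees M) :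
    (linearReesEquiv M σ h s : Polynomial R) = (s : Polynomial R).map (σ : R →+* R) := rfl

theorem monomialMem_comap {M : Submodule K R} {σ : R ≃ₐ[K] R} {h : ∀ f, σ f ∈ M ↔ f ∈ M}
    {P : Ideal (linearRees M)} {f : R} (hf : f ∈ M) :
    MonomialMem (P.comap (linearReesEquiv M σ h)) f ↔ MonomialMem P (σ f) := by
  rw [monomialMem_iff hf, monomialMem_iff ((h f).2 hf), Ideal.mem_comap]
  have : linearReesEquiv M σ h ⟨_, monomial_mem_linearRees M hf⟩
      = ⟨_, monomial_mem_linearRees M ((h f).2 hf)⟩ :=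
    Subtype.ext ((coe_linearReesEquiv _ _ _ _).trans (Polynomial.map_monomial _))
  rw [this]

/-- The automorphism permutes the generators `uX` of the ideal, hence preserves the ideal and
permutes its minimal primes. -/
theorem comap_linearReesEquiv_mem_minimalPrimes {M V : Submodule K R} {σ : R ≃ₐ[K] R}
    (h : ∀ f, σ f ∈ M ↔ f ∈ M) (hV : ∀ f, σ f ∈ V ↔ f ∈ V) {P : Ideal (linearRees M)}
    (hP : P ∈ (linearReesIdeal M V).minimalPrimes) :
    P.comap (linearReesEquiv M σ h) ∈ (linearReesIdeal M V).minimalPrimes := by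
  have hI : (linearReesIdeal M V).comap (linearReesEquiv M σ h : linearRees M →+* linearRees M)
      = linearReesIdeal M V := by
    apply le_antisymm
    · intro s hs
      have hle : linearReesIdeal M V ≤ (linearReesIdeal M V).comap
          ((linearReesEquiv M σ h).symm : linearRees M →+* linearRees M) := by
        refine Ideal.span_le.2 ?_
        rintro t ⟨u, hu, ht⟩
        refine Ideal.subset_span ⟨σ.symm u, (hV _).1 (by simpa using hu), ?_⟩
        apply Polynomial.map_injective (σ : R →+* R) σ.injective
        rw [Polynomial.map_monomial, ← coe_linearReesEquiv M σ h]
        simp [ht]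
      simpa using hle hs
    · refine Ideal.span_le.2 ?_
      rintro t ⟨u, hu, ht⟩
      refine Ideal.subset_span ⟨σ u, (hV u).2 hu, ?_⟩
      rw [RingHom.coe_coe, coe_linearReesEquiv, ht, Polynomial.map_monomial]
      rfl
  have := Ideal.minimalPrimes_comap_of_surjective
    (f := (linearReesEquiv M σ h : linearRees M →+* linearRees M))
    (linearReesEquiv M σ h).surjective hP
  rwa [hI] at this

/-- Let a family of automorphisms of a domain `R` preserve the finite-dimensional subspaces `V` and
`F`, where no subspace of codimension one of `V` is preserved. Under the hypotheses `hcover`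
(irreducibility of the family) and `hrel` (a dimension bound) the elements of `F` are constants. -/
theorem exists_algebraMap_eq_of_forall_hyperplane [IsAlgClosed K] [IsDomain R] {Γ : Type*}
    (L : Γ → R ≃ₐ[K] R) (e : Γ) (he : ∀ f, L e f = f) {V F : Submodule K R} (hVfg : V.FG)
    (hFfg : F.FG) (h1 : 1 ∈ F) (hV0 : V ≠ ⊥) (hV : ∀ g f, L g f ∈ V ↔ f ∈ V)
    (hF : ∀ g f, L g f ∈ F ↔ f ∈ F)
    (hrel : ∀ y ∈ V * F, ∀ z ∈ V * F, ∀ u ∈ V, u ≠ 0 → ∃ p : MvPolynomial (Fin 2) K, p ≠ 0 ∧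
      aeval ![algebraMap R (FractionRing R) y / algebraMap R (FractionRing R) u,
        algebraMap R (FractionRing R) z / algebraMap R (FractionRing R) u] p = 0)
    (hcover : ∀ 𝓦 : Set (Submodule K R), 𝓦.Finite → ∀ W ≤ V, (∀ W' ∈ 𝓦, W' ≤ V) →
      (∀ g, ∃ W' ∈ 𝓦, ∀ u ∈ W, L g u ∈ W') → ∃ W' ∈ 𝓦, ∀ g, ∀ u ∈ W, L g u ∈ W')
    (hplane : ∀ W ≤ V, (∀ g, ∀ u ∈ W, L g u ∈ W) → ∀ u₀ ∈ V, u₀ ∉ W →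
      ∃ u ∈ V, ∀ c : K, u - c • u₀ ∉ W) :
    ∀ f ∈ F, ∃ c : K, algebraMap K R c = f := by
  set M := V * F with hM
  have hVM : V ≤ M := fun u hu => by simpa using Submodule.mul_mem_mul hu h1
  have hMfg : M.FG := hVfg.mul hFfg
  have hLM : ∀ g f, L g f ∈ M ↔ f ∈ M := by
    intro g
    have h1 : M.map (L g).toLinearMap = M := by
      have hmap : ∀ W : Submodule K R, (∀ f, L g f ∈ W ↔ f ∈ W) →
          W.map (L g : R →ₐ[K] R).toLinearMap = W := by
        intro W hW
        ext x
        constructor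
        · rintro ⟨f, hf, rfl⟩
          exact (hW f).2 hf
        · exact fun hx => ⟨(L g).symm x, (hW _).1 (by simpa using hx), by simp⟩
      have := Submodule.map_mul V F (L g : R →ₐ[K] R)
      rw [hmap V (hV g), hmap F (hF g)] at this
      exact this
    intro f
    constructor
    · intro hf
      rw [← h1] at hf
      obtain ⟨f', hf', h⟩ := hf
      rwa [← (L g).injective h]
    · intro hf
      rw [← h1]
      exact ⟨f, hf, rfl⟩
  obtain ⟨v, hv, hv0⟩ := Submodule.exists_mem_ne_zero_of_ne_bot hV0
  have hvP : ∀ P ∈ (linearReesIdeal M V).minimalPrimes, ∀ u ∈ V, MonomialMem P u := by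
    intro P hP u hu
    exact ⟨⟨_, monomial_mem_linearRees M (hVM hu)⟩, hP.1.2 (Ideal.subset_span ⟨u, hu, rfl⟩), rfl⟩
  have hfin : (linearReesIdeal M V).minimalPrimes.Finite := by
    have := isNoetherianRing_linearRees M hMfg
    exact Ideal.finite_minimalPrimes_of_isNoetherianRing _ _
  -- each proper `colonSubmodule` has codimension one
  have hcodim : ∀ P ∈ (linearReesIdeal M V).minimalPrimes, (∃ f ∈ M, ¬ MonomialMem P f) →
      ∃ u₀ ∈ V, u₀ ∉ colonSubmodule V F P ∧
        ∀ u ∈ V, ∃ c : K, u - c • u₀ ∈ colonSubmodule V F P := by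
    rintro P hP ⟨f₁, hf₁, hf₁P⟩
    obtain ⟨u₀, hu₀, f₀, hf₀, hP₀⟩ : ∃ u ∈ V, ∃ f ∈ F, ¬ MonomialMem P (u * f) := by
      by_contra! hcon
      apply hf₁P
      clear hf₁P
      rw [hM] at hf₁
      induction hf₁ using Submodule.mul_induction_on' with
      | mem_mul_mem m hm n hn => exact hcon m hm n hn
      | add x _ y _ hx hy => exact hx.add hy
    refine ⟨u₀, hu₀, fun h => hP₀ (h.2 f₀ hf₀), fun u hu => ?_⟩
    have hm := fun {u f} (hu : u ∈ V) (hf : f ∈ F) => Submodule.mul_mem_mul hu hf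
    obtain ⟨c, hc⟩ := exists_monomialMem_sub_smul hP.1.1 (hm hu hf₀) (hm hu₀ hf₀) (hVM hv) hv0
      (hvP P hP v hv) hP₀ (hrel _ (hm hu hf₀) _ (hm hu₀ hf₀) v hv hv0)
    have hw : u - c • u₀ ∈ V := sub_mem hu (V.smul_mem c hu₀)
    refine ⟨c, hw, fun f hf => ?_⟩
    rw [← smul_mul_assoc, ← sub_mul] at hc
    rw [monomialMem_iff (hm hw hf)]
    rw [monomialMem_iff (hm hw hf₀)] at hc
    rw [monomialMem_iff (hm hu₀ hf₀)] at hP₀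
    -- With `w = u - c u₀`, the identity `(w f)(u₀ f₀) = (w f₀)(u₀ f)` passes from the single `f₀`
    -- to every `f`.
    refine (hP.1.1.mem_or_mem (?_ : _ * _ ∈ P)).resolve_right hP₀
    have := P.mul_mem_right ⟨_, monomial_mem_linearRees M (hm hu₀ hf)⟩ hc
    convert this using 1
    apply Subtype.ext
    rw [MulMemClass.coe_mul, MulMemClass.coe_mul, Polynomial.monomial_mul_monomial,
      Polynomial.monomial_mul_monomial]
    congr 1
    ring
  by_cases hall : ∀ P ∈ (linearReesIdeal M V).minimalPrimes, ∀ f ∈ M, MonomialMem P f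
  · -- the ideal contains a power of the irrelevant ideal
    let J : Ideal (linearRees M) := Ideal.span {s | ∃ f ∈ M, (s : Polynomial R) = .monomial 1 f}
    have hJ : J ≤ (linearReesIdeal M V).radical := by
      rw [← Ideal.sInf_minimalPrimes]
      refine Ideal.span_le.2 ?_
      rintro s ⟨f, hf, hs⟩
      rw [SetLike.mem_coe, Submodule.mem_sInf]
      intro P hP
      obtain ⟨t, ht, ht'⟩ := hall P hP f hf
      rwa [Subtype.ext (hs.trans ht'.symm)]
    have := isNoetherianRing_linearRees M hMfg
    obtain ⟨N, hN⟩ := Ideal.exists_pow_le_of_le_radical_of_fg hJ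
      ((isNoetherianRing_iff_ideal_fg _).1 this J)
    have hpow : M ^ (N + 1) ≤ V * M ^ N := by
      intro f hf
      obtain ⟨s, hs, hs'⟩ := exists_mem_pow_of_mem_pow
        (J := J) (fun f hf => Ideal.subset_span ⟨f, hf, rfl⟩) hf
      have h2 := (coeff_mem_of_mem_linearReesIdeal M V
        (hN (Ideal.pow_le_pow_right (Nat.le_succ N) hs))).2 N
      rwa [hs', Polynomial.coeff_monomial_same] at h2
    intro f hf
    refine IsIntegral.exists_algebraMap_eq
      (isIntegral_of_smul_mem_submodule (M ^ (N + 1)) ?_ (hMfg.pow _) f ?_)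
    · intro h0
      have := Submodule.pow_mem_pow M (hVM hv) (N + 1)
      rw [h0, Submodule.mem_bot] at this
      exact hv0 (pow_eq_zero_iff (Nat.succ_ne_zero N) |>.1 this)
    -- Multiplication by `f` maps `M^(N+1) ⊆ V M^N` into `V F M^N = M^(N+1)`; the determinant trick
    -- gives integrality.
    · intro m hm
      have h2 := Submodule.mul_mem_mul (hpow hm) hf
      rw [smul_eq_mul, mul_comm, pow_succ']
      rwa [mul_right_comm] at h2
  · exfalso
    push Not at hall
    obtain ⟨P, hP, hPM⟩ := hall
    let 𝓟 : Set (Ideal (linearRees M)) :=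
      {P | P ∈ (linearReesIdeal M V).minimalPrimes ∧ ∃ f ∈ M, ¬ MonomialMem P f}
    obtain ⟨_, ⟨P', hP', rfl⟩, hcov⟩ := hcover (colonSubmodule V F '' 𝓟)
      ((hfin.subset fun _ h => h.1).image _) (colonSubmodule V F P) (fun u hu => hu.1)
      (by rintro _ ⟨Q, -, rfl⟩ u hu; exact hu.1) (by
        -- Pulling `P` back along the inverse of `L g` gives another minimal prime, whose hyperplane
        -- contains the image under `L g` of that of `P`.
        intro g
        have hsymm : ∀ W : Submodule K R, (∀ f, L g f ∈ W ↔ f ∈ W) →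
            ∀ f, (L g).symm f ∈ W ↔ f ∈ W := fun W hW f => by
          rw [← hW, AlgEquiv.apply_symm_apply]
        refine ⟨_, ⟨P.comap (linearReesEquiv M (L g).symm (hsymm M (hLM g))),
          ⟨comap_linearReesEquiv_mem_minimalPrimes _ (hsymm V (hV g)) hP, ?_⟩, rfl⟩, ?_⟩
        · obtain ⟨f, hf, hfP⟩ := hPM
          exact ⟨L g f, (hLM g f).2 hf, by
            rwa [monomialMem_comap ((hLM g f).2 hf), AlgEquiv.symm_apply_apply]⟩
        · rintro u ⟨hu, huP⟩
          refine ⟨(hV g u).2 hu, fun f hf => ?_⟩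
          rw [monomialMem_comap (Submodule.mul_mem_mul ((hV g u).2 hu) hf), map_mul,
            AlgEquiv.symm_apply_apply]
          exact huP _ ((hsymm F (hF g) f).2 hf))
    obtain ⟨u₀, hu₀, hu₀P, hc⟩ := hcodim P hP hPM
    obtain ⟨u₁, hu₁, hu₁P, -⟩ := hcodim P' hP'.1 hP'.2
    have hle : colonSubmodule V F P ≤ colonSubmodule V F P' := fun u hu => by
      simpa [he] using hcov e u hu
    -- The identity gives one inclusion. A hyperplane contained in a proper subspace of `V` equals
    -- it, so `hcov` says that this hyperplane is invariant.
    have hge : colonSubmodule V F P' ≤ colonSubmodule V F P := by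
      intro u hu
      by_contra huP
      obtain ⟨a, ha⟩ := hc u hu.1
      obtain ⟨b, hb⟩ := hc u₁ hu₁
      have ha0 : a ≠ 0 := by
        rintro rfl
        exact huP (by simpa using ha)
      apply hu₁P
      have h2 := hle (sub_mem hb (Submodule.smul_mem _ (b / a) ha))
      have h3 := add_mem h2 (Submodule.smul_mem _ (b / a) hu)
      rw [smul_sub, smul_smul, div_mul_cancel₀ _ ha0] at h3
      simpa using h3
    obtain ⟨u, hu, hunot⟩ := hplane (colonSubmodule V F P) (fun u hu => hu.1)
      (fun g u hu => hge (hcov g u hu)) u₀ hu₀ hu₀P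
    obtain ⟨c, hc⟩ := hc u hu
    exact hunot c hc

end FixedHyperplane

/-! ### Linear groups: eigenvectors, Burnside, Kolchin, invariant flags -/

section InvariantSubspaces

open Module

variable {K V Γ : Type*} [Field K] [AddCommGroup V] [Module K V] [Group Γ]

/-- The endomorphisms of a quotient by an invariant subspace. -/
def quotientEnd (ρ : Γ →* End K V) (U : Submodule K V) (hU : ∀ g, ∀ u ∈ U, ρ g u ∈ U) :
    Γ →* End K (V ⧸ U) where
  toFun g := U.mapQ U (ρ g) (hU g)
  map_one' := by
    ext v
    simp
  map_mul' g h := by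
    ext v
    simp

theorem exists_minimal_invariant [FiniteDimensional K V] [Nontrivial V] (ρ : Γ →* End K V) :
    ∃ W : Submodule K V, Minimal (fun W => W ≠ ⊥ ∧ ∀ g, ∀ w ∈ W, ρ g w ∈ W) W := by
  obtain ⟨W, hW, hmin⟩ := WellFounded.has_min (wellFounded_lt (α := Submodule K V))
    {W | W ≠ ⊥ ∧ ∀ g, ∀ w ∈ W, ρ g w ∈ W} ⟨⊤, top_ne_bot, fun _ _ _ => Submodule.mem_top⟩
  exact ⟨W, hW, fun W' hW' hle => not_lt_iff_le_imp_ge.1 (hmin W' hW') hle⟩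

/-- Commuting operators over an algebraically closed field have a common eigenvector. -/
theorem exists_common_eigenvector [IsAlgClosed K] [FiniteDimensional K V] [Nontrivial V]
    (ρ : Γ →* End K V) (hcomm : ∀ g h : Γ, g * h = h * g) :
    ∃ v : V, v ≠ 0 ∧ ∀ g, ∃ c : K, ρ g v = c • v := by
  obtain ⟨W, ⟨hW0, hW⟩, hmin⟩ := exists_minimal_invariant ρ
  obtain ⟨v, hv, hv0⟩ := Submodule.exists_mem_ne_zero_of_ne_bot hW0
  refine ⟨v, hv0, fun g => ?_⟩
  have : Nontrivial W := ⟨⟨⟨v, hv⟩, 0, fun h => hv0 (congrArg Subtype.val h)⟩⟩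
  obtain ⟨c, hc⟩ := Module.End.exists_eigenvalue ((ρ g).restrict (hW g))
  obtain ⟨w, hw⟩ := hc.exists_hasEigenvector
  -- By commutativity an eigenspace of `ρ g` is invariant, so the minimal `W` lies inside it.
  have hle : W ≤ W ⊓ End.eigenspace (ρ g) c := by
    refine hmin ⟨?_, ?_⟩ inf_le_left
    · refine Submodule.ne_bot_iff _ |>.2 ⟨w, ⟨w.2, ?_⟩, fun h => hw.2 (Subtype.ext h)⟩
      rw [SetLike.mem_coe, End.mem_eigenspace_iff]
      exact congrArg Subtype.val hw.apply_eq_smul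
    · rintro h u ⟨hu, hu'⟩
      refine ⟨hW h u hu, ?_⟩
      rw [SetLike.mem_coe, End.mem_eigenspace_iff] at hu' ⊢
      rw [← Module.End.mul_apply, ← map_mul, hcomm, map_mul, Module.End.mul_apply, hu', map_smul]
  exact ⟨c, End.mem_eigenspace_iff.1 (hle hv).2⟩

/-- **Burnside's theorem**: an irreducible algebra of operators on a finite-dimensional space over
an algebraically closed field contains all operators. -/
theorem adjoin_eq_top_of_irreducible [IsAlgClosed K] [FiniteDimensional K V] [Nontrivial V]
    (S : Set (End K V))
    (hS : ∀ W : Submodule K V, (∀ a ∈ S, ∀ w ∈ W, a w ∈ W) → W = ⊥ ∨ W = ⊤) :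
    Algebra.adjoin K S = ⊤ := by
  set A := Algebra.adjoin K S
  have hsimple : IsSimpleModule A V := by
    rw [isSimpleModule_iff]
    refine { exists_pair_ne := ⟨⊥, ⊤, bot_ne_top⟩, eq_bot_or_eq_top := fun N => ?_ }
    rcases hS (N.restrictScalars K) (fun a ha w hw =>
      N.smul_mem (⟨a, Algebra.subset_adjoin ha⟩ : A) hw) with h | h
    · exact Or.inl ((Submodule.restrictScalars_eq_bot_iff K A V).1 h)
    · exact Or.inr ((Submodule.restrictScalars_eq_top_iff K A V).1 h)
  rw [eq_top_iff]
  intro f _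
  -- By Schur's lemma the commutant consists of scalars, so `f` commutes with it, and the density
  -- theorem matches `f` on a basis by an element of `A`.
  have hK := IsSimpleModule.algebraMap_end_bijective_of_isAlgClosed (A := A) (V := V) K
  let f' : End (End A V) V :=
    { f with
      map_smul' := fun φ v => by
        obtain ⟨c, rfl⟩ := hK.2 φ
        exact f.map_smul c v }
  classical
  obtain ⟨r, hr⟩ := jacobson_density f' (Finset.univ.image (finBasis K V))
  have : f = r := (finBasis K V).ext fun i => hr _ (by simp)
  rw [this]
  exact r.2

/-- **Kolchin's theorem**: a group of unipotent operators fixes a nonzero vector. -/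
theorem exists_fixed_vector_of_unipotent [IsAlgClosed K] [FiniteDimensional K V] [Nontrivial V]
    (ρ : Γ →* End K V) (hρ : ∀ g, IsNilpotent (ρ g - 1)) :
    ∃ v : V, v ≠ 0 ∧ ∀ g, ρ g v = v := by
  obtain ⟨W, ⟨hW0, hW⟩, hmin⟩ := exists_minimal_invariant ρ
  obtain ⟨v, hv, hv0⟩ := Submodule.exists_mem_ne_zero_of_ne_bot hW0
  refine ⟨v, hv0, fun g => ?_⟩
  have : Nontrivial W := ⟨⟨⟨v, hv⟩, 0, fun h => hv0 (congrArg Subtype.val h)⟩⟩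
  let σ : Γ →* End K W :=
    { toFun := fun g => (ρ g).restrict (hW g)
      map_one' := by ext; simp
      map_mul' := fun g h => by ext; simp }
  have hnil : ∀ g, IsNilpotent (σ g - 1) := by
    intro g
    obtain ⟨k, hk⟩ := hρ g
    refine ⟨k, ?_⟩
    have key : ∀ m (w : W), (((σ g - 1 : End K W) ^ m : End K W) w : V) = ((ρ g - 1 : End K V) ^ m : End K V) w := by
      intro m
      induction m with
      | zero => exact fun w => rfl
      | succ m ih =>
        intro w
        rw [pow_succ, pow_succ, Module.End.mul_apply, Module.End.mul_apply, ih]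
        rfl
    ext w
    rw [key, hk]
    rfl
  have hburn : Algebra.adjoin K (Set.range σ) = ⊤ := by
    apply adjoin_eq_top_of_irreducible
    intro N hN
    by_cases hN0 : N = ⊥
    · exact Or.inl hN0
    right
    have hle : W ≤ N.map W.subtype := by
      refine hmin ⟨?_, ?_⟩ (Submodule.map_subtype_le W N)
      · exact fun h => hN0 (Submodule.map_injective_of_injective W.subtype_injective
          (h.trans (Submodule.map_bot _).symm))
      · rintro h _ ⟨w, hw, rfl⟩
        exact ⟨σ h w, hN _ ⟨h, rfl⟩ w hw, rfl⟩
    rw [eq_top_iff]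
    intro w _
    obtain ⟨w', hw', h⟩ := hle w.2
    rwa [← Subtype.ext h]
  -- By Burnside every `a` is a combination of operators `σ h`, and `(σ g - 1) σ h` is a difference
  -- of the nilpotents `σ (g h) - 1` and `σ h - 1`.
  have htrace : ∀ a : End K W, LinearMap.trace K W ((σ g - 1) * a) = 0 := by
    intro a
    have ha : a ∈ Subalgebra.toSubmodule (Algebra.adjoin K (Set.range σ)) := by
      rw [hburn]
      trivial
    rw [Algebra.adjoin_eq_span, ← MonoidHom.coe_mrange, Submonoid.closure_eq] at ha
    induction ha using Submodule.span_induction with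
    | mem x hx =>
      obtain ⟨h, rfl⟩ := hx
      have : (σ g - 1) * σ h = (σ (g * h) - 1) - (σ h - 1) := by
        rw [map_mul, sub_mul, one_mul]
        abel
      rw [this, map_sub, (LinearMap.isNilpotent_trace_of_isNilpotent (hnil _)).eq_zero,
        (LinearMap.isNilpotent_trace_of_isNilpotent (hnil _)).eq_zero, sub_zero]
    | zero => simp
    | add x y _ _ hx hy => rw [mul_add, map_add, hx, hy, add_zero]
    | smul c x _ hx => rw [mul_smul_comm, map_smul, hx, smul_zero]
  have hfix : (σ g - 1) ⟨v, hv⟩ = 0 := by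
    rw [← Module.forall_dual_apply_eq_zero_iff K]
    intro φ
    -- Against the rank one operator `φ ⊗ v` the trace is `φ ((σ g - 1) v)`.
    have := htrace (φ.smulRight ⟨v, hv⟩)
    have h2 : (σ g - 1) * φ.smulRight ⟨v, hv⟩ = φ.smulRight ((σ g - 1) ⟨v, hv⟩) := by
      apply LinearMap.ext
      intro w
      rw [Module.End.mul_apply, LinearMap.smulRight_apply, LinearMap.smulRight_apply, map_smul]
    rwa [h2, LinearMap.trace_smulRight] at this
  exact sub_eq_zero.1 (congrArg Subtype.val hfix)

/-- A linear group is solvable if every proper invariant subspace is a hyperplane of an invariant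
subspace. -/
theorem isSolvable_of_invariant_flag [FiniteDimensional K V] (ρ : Γ →* End K V)
    (hinj : Function.Injective ρ)
    (hflag : ∀ U : Submodule K V, (∀ g, ∀ u ∈ U, ρ g u ∈ U) → U ≠ ⊤ →
      ∃ U' : Submodule K V, (∀ g, ∀ u ∈ U', ρ g u ∈ U') ∧ U < U' ∧
        ∃ ξ : Dual K V, ∀ y ∈ U', y ∈ U ↔ ξ y = 0) : Group.IsSolvable Γ := by
  -- Invariant subspaces fixed pointwise by some derived subgroup. A maximal one is the whole space,
  -- because the flag hypothesis enlarges any other at the cost of two derived steps.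
  let good : Set (Submodule K V) := {U | (∀ g, ∀ u ∈ U, ρ g u ∈ U) ∧
    ∃ k, ∀ d ∈ derivedSeries Γ k, ∀ u ∈ U, ρ d u = u}
  obtain ⟨U, ⟨hU, k, hk⟩, hmax⟩ := WellFounded.has_min
    (wellFounded_gt (α := Submodule K V)) good
    ⟨⊥, fun g u hu => by rw [(Submodule.mem_bot K).1 hu, map_zero]; exact zero_mem _,
      0, fun d _ u hu => by rw [(Submodule.mem_bot K).1 hu, map_zero]⟩
  by_cases hUtop : U = ⊤
  · refine ⟨k, (Subgroup.eq_bot_iff_forall _).2 fun d hd => hinj ?_⟩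
    rw [map_one]
    ext v
    exact hk d hd v (hUtop ▸ Submodule.mem_top)
  exfalso
  obtain ⟨U', hU', hlt, ξ, hξ⟩ := hflag U hU hUtop
  refine hmax U' ⟨hU', k + 2, ?_⟩ hlt
  obtain ⟨y₁, hy₁, hy₁U⟩ := SetLike.exists_of_lt hlt
  have hξ₁ : ξ y₁ ≠ 0 := fun h => hy₁U ((hξ y₁ hy₁).2 h)
  obtain ⟨y₀, hy₀, hξ₀⟩ : ∃ y ∈ U', ξ y = 1 :=
    ⟨(ξ y₁)⁻¹ • y₁, U'.smul_mem _ hy₁, by rw [map_smul, smul_eq_mul, inv_mul_cancel₀ hξ₁]⟩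
  have hdec : ∀ y ∈ U', y - ξ y • y₀ ∈ U := fun y hy =>
    (hξ _ (sub_mem hy (U'.smul_mem _ hy₀))).2 (by simp [hξ₀])
  have hξU : ∀ u ∈ U, ξ u = 0 := fun u hu => (hξ u (hlt.le hu)).1 hu
  let χ : Γ →* K :=
    { toFun := fun g => ξ (ρ g y₀)
      map_one' := by simp [hξ₀]
      map_mul' := fun g h => by
        have h1 := hξU _ (hU g _ (hdec _ (hU' h y₀ hy₀)))
        rw [map_sub, map_smul, map_sub, map_smul, sub_eq_zero, smul_eq_mul] at h1
        rw [map_mul, Module.End.mul_apply, h1, mul_comm] }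
  have hχ : ∀ d ∈ derivedSeries Γ (k + 1), χ d = 1 := by
    intro d hd
    have h1 : d ∈ derivedSeries Γ 1 := derivedSeries_antitone Γ (Nat.le_add_left 1 k) hd
    rw [derivedSeries_one] at h1
    have h2 := Abelianization.commutator_subset_ker χ.toHomUnits h1
    simpa using congrArg Units.val (MonoidHom.mem_ker.1 h2)
  have hmove : ∀ d ∈ derivedSeries Γ (k + 1), ∀ y ∈ U', ρ d y - y ∈ U := by
    intro d hd y hy
    refine (hξ _ (sub_mem (hU' d y hy) hy)).2 ?_
    have h1 := hξU _ (hU d _ (hdec y hy))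
    have h2 : ξ (ρ d y₀) = 1 := hχ d hd
    rw [map_sub, map_smul, map_sub, map_smul, h2, smul_eq_mul, mul_one] at h1
    rw [map_sub, h1]
  have hfixU : ∀ d ∈ derivedSeries Γ (k + 1), ∀ u ∈ U, ρ d u = u := fun d hd =>
    hk d (derivedSeries_antitone Γ (Nat.le_succ k) hd)
  -- Operators trivial on both `U` and `U' / U` commute on `U'`; the second derived step therefore
  -- fixes `U'`.
  have hcomm : ∀ a ∈ derivedSeries Γ (k + 1), ∀ b ∈ derivedSeries Γ (k + 1), ∀ y ∈ U',
      ρ a (ρ b y) = ρ b (ρ a y) := by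
    intro a ha b hb y hy
    have h1 := hfixU a ha _ (hmove b hb y hy)
    have h2 := hfixU b hb _ (hmove a ha y hy)
    rw [map_sub, sub_eq_iff_eq_add] at h1 h2
    rw [h1, h2]
    abel
  let Fix : Subgroup Γ :=
    { carrier := {d | ∀ y ∈ U', ρ d y = y}
      one_mem' := fun y _ => by simp
      mul_mem' := fun {a b} ha hb y hy => by
        rw [map_mul, Module.End.mul_apply, hb y hy, ha y hy]
      inv_mem' := fun {a} ha y hy => by
        conv_lhs => rw [← ha y hy]
        rw [← Module.End.mul_apply, ← map_mul, inv_mul_cancel, map_one, Module.End.one_apply] }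
  have hle : derivedSeries Γ (k + 2) ≤ Fix := by
    rw [derivedSeries_succ, Subgroup.commutator_le]
    intro a ha b hb y hy
    have h1 := hcomm a ha b hb _ (hU' (b * a)⁻¹ y hy)
    rw [← Module.End.mul_apply, ← Module.End.mul_apply, ← Module.End.mul_apply,
      ← Module.End.mul_apply, ← map_mul, ← map_mul, ← map_mul, ← map_mul] at h1
    rw [commutatorElement_def, show a * b * a⁻¹ * b⁻¹ = a * b * (b * a)⁻¹ by group, h1,
      mul_inv_cancel, map_one, Module.End.one_apply]
  exact fun d hd => hle hd

end InvariantSubspaces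

/-! ### Irreducible components of Noetherian groups -/

section NoetherianGroup

open Set Pointwise

variable {Γ : Type*} [Group Γ] [TopologicalSpace Γ] [SeparatelyContinuousMul Γ]

/-- Zariski multiplication is continuous only in each variable, so the factors are treated in turn:
each translate `x Y` lies in one of the two closed sets, and the `x` with `x Y ⊆ Z` form a closed
set. -/
theorem IsIrreducible.mul_of_separatelyContinuous {X Y : Set Γ} (hX : IsIrreducible X)
    (hY : IsIrreducible Y) : IsIrreducible (X * Y) := by
  refine ⟨hX.1.mul hY.1, isPreirreducible_iff_isClosed_union_isClosed.2 ?_⟩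
  intro Z₁ Z₂ h₁ h₂ hsub
  have hcl : ∀ Z : Set Γ, IsClosed Z → IsClosed {x | ∀ y ∈ Y, x * y ∈ Z} := by
    intro Z hZ
    simp only [ofPred_forall]
    exact isClosed_biInter fun y _ => hZ.preimage SeparatelyContinuousMul.continuous_mul_const
  have := isPreirreducible_iff_isClosed_union_isClosed.1 hX.2 _ _ (hcl Z₁ h₁) (hcl Z₂ h₂) (by
    intro x hx
    have hxY : IsPreirreducible ((x * ·) '' Y) :=
      hY.2.image _ SeparatelyContinuousMul.continuous_const_mul.continuousOn
    rcases isPreirreducible_iff_isClosed_union_isClosed.1 hxY Z₁ Z₂ h₁ h₂ (by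
      rintro _ ⟨y, hy, rfl⟩
      exact hsub (mul_mem_mul hx hy)) with h | h
    · exact Or.inl fun y hy => h ⟨y, hy, rfl⟩
    · exact Or.inr fun y hy => h ⟨y, hy, rfl⟩)
  rcases this with h | h
  · refine Or.inl ?_
    rintro _ ⟨x, hx, y, hy, rfl⟩
    exact h hx y hy
  · refine Or.inr ?_
    rintro _ ⟨x, hx, y, hy, rfl⟩
    exact h hx y hy

/-- The product of `X` with the identity component is irreducible and contains both, so maximality
applies. -/
theorem IsIrreducible.subset_irreducibleComponent_one {X : Set Γ} (hX : IsIrreducible X)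
    (h1 : 1 ∈ X) : X ⊆ irreducibleComponent (1 : Γ) := by
  have h := hX.mul_of_separatelyContinuous (isIrreducible_irreducibleComponent (x := (1 : Γ)))
  rw [← eq_irreducibleComponent h.2 fun y hy => ⟨1, h1, y, hy, one_mul y⟩]
  exact fun x hx => ⟨x, hx, 1, mem_irreducibleComponent, mul_one x⟩

variable [ContinuousInv Γ]

variable (Γ) in
/-- The irreducible component of the identity. -/
def identityComponent : Subgroup Γ where
  carrier := irreducibleComponent (1 : Γ)
  one_mem' := mem_irreducibleComponent
  mul_mem' := fun ha hb =>
    (isIrreducible_irreducibleComponent.mul_of_separatelyContinuous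
      isIrreducible_irreducibleComponent).subset_irreducibleComponent_one
      ⟨1, mem_irreducibleComponent, 1, mem_irreducibleComponent, mul_one 1⟩ (mul_mem_mul ha hb)
  inv_mem' := fun {a} ha =>
    (isIrreducible_irreducibleComponent.image (fun x : Γ => x⁻¹)
      continuous_inv.continuousOn).subset_irreducibleComponent_one
      ⟨1, mem_irreducibleComponent, inv_one⟩ ⟨a, ha, rfl⟩

theorem isClosed_identityComponent : IsClosed (identityComponent Γ : Set Γ) :=
  isClosed_irreducibleComponent

theorem isIrreducible_identityComponent : IsIrreducible (identityComponent Γ : Set Γ) :=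
  isIrreducible_irreducibleComponent

/-- Finitely many irreducible closed sets cover the group, and each, translated so as to contain
`1`, lies in the identity component; hence each meets only one coset. -/
theorem finite_quotient_identityComponent [TopologicalSpace.NoetherianSpace Γ] :
    Finite (Γ ⧸ identityComponent Γ) := by
  obtain ⟨S, hS, -, hirr, hcov⟩ :=
    TopologicalSpace.NoetherianSpace.exists_finite_set_isClosed_irreducible
      (isClosed_univ (X := Γ))
  have := hS.to_subtype
  choose p hp using fun t : S => (hirr t t.2).1
  refine Finite.of_surjective (fun t : S => (p t : Γ ⧸ identityComponent Γ)) fun q => ?_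
  induction q using QuotientGroup.induction_on with
  | H g =>
    obtain ⟨t, ht, hg⟩ : g ∈ ⋃₀ S := hcov ▸ mem_univ g
    refine ⟨⟨t, ht⟩, QuotientGroup.eq.2 ?_⟩
    exact ((hirr t ht).image ((p ⟨t, ht⟩)⁻¹ * ·)
      SeparatelyContinuousMul.continuous_const_mul.continuousOn).subset_irreducibleComponent_one
        ⟨_, hp ⟨t, ht⟩, inv_mul_cancel _⟩ ⟨g, hg, rfl⟩

/-- A connected Noetherian group is irreducible. -/
theorem isIrreducible_univ_of_connected [TopologicalSpace.NoetherianSpace Γ] [ConnectedSpace Γ] :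
    IsIrreducible (univ : Set Γ) := by
  have := finite_quotient_identityComponent (Γ := Γ)
  have hclosed : ∀ q : Γ ⧸ identityComponent Γ, IsClosed {g : Γ | (g : Γ ⧸ identityComponent Γ) = q} := by
    intro q
    induction q using QuotientGroup.induction_on with
    | H a =>
      have : {g : Γ | (g : Γ ⧸ identityComponent Γ) = a} = (a⁻¹ * ·) ⁻¹' identityComponent Γ := by
        ext g
        rw [mem_ofPred_eq, eq_comm, QuotientGroup.eq]
        rfl
      rw [this]
      exact isClosed_identityComponent.preimage SeparatelyContinuousMul.continuous_const_mul
  have hopen : IsOpen (identityComponent Γ : Set Γ) := by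
    have h : (identityComponent Γ : Set Γ)ᶜ
        = ⋃ q ∈ {q : Γ ⧸ identityComponent Γ | q ≠ ((1 : Γ) : Γ ⧸ identityComponent Γ)},
          {g : Γ | (g : Γ ⧸ identityComponent Γ) = q} := by
      ext g
      simp only [mem_compl_iff, SetLike.mem_coe, mem_ofPred_eq, mem_iUnion, exists_prop,
        exists_eq_right']
      rw [Ne, eq_comm, QuotientGroup.eq, inv_one, one_mul]
    rw [← isClosed_compl_iff, h]
    exact (toFinite _).isClosed_biUnion fun q _ => hclosed q
  rw [← IsClopen.eq_univ ⟨isClosed_identityComponent, hopen⟩ ⟨1, one_mem (identityComponent Γ)⟩]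
  exact isIrreducible_identityComponent

end NoetherianGroup

namespace LinAlgGrp

/-! ### The Zariski topology on `SL_n(K)` -/

section ZariskiSL

variable {K : Type*} [Field K] {n : ℕ}

/-- Evaluation of polynomials in the matrix entries at an element of `SL_n(K)`. -/
noncomputable def evalAt (g : Matrix.SpecialLinearGroup (Fin n) K) :
    MvPolynomial (Fin n × Fin n) K →ₐ[K] K :=
  aeval fun p => g.1 p.1 p.2

/-- The Zariski topology on `SL_n(K)`. -/
abbrev zariskiSL : TopologicalSpace (Matrix.SpecialLinearGroup (Fin n) K) :=
  (zariskiTopology (Fin n × Fin n) K).induced fun g p => g.1 p.1 p.2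

attribute [local instance] zariskiSL

theorem isClosed_zariskiTopology_iff {σ : Type*} {Z : Set (σ → K)} :
    @IsClosed _ (zariskiTopology σ K) Z ↔ ∃ I : Ideal (MvPolynomial σ K), Z = zeroLocus K I := by
  rw [← @isOpen_compl_iff _ _ (zariskiTopology σ K)]
  change Zᶜᶜ ∈ _ ↔ _
  rw [compl_compl]
  rfl

theorem isClosed_zariskiSL_iff {Z : Set (Matrix.SpecialLinearGroup (Fin n) K)} :
    IsClosed Z ↔ ∃ I : Ideal (MvPolynomial (Fin n × Fin n) K),
      Z = {g | ∀ p ∈ I, evalAt g p = 0} := by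
  rw [@isClosed_induced_iff _ _ (zariskiTopology (Fin n × Fin n) K)]
  constructor
  · rintro ⟨t, ht, rfl⟩
    obtain ⟨I, rfl⟩ := isClosed_zariskiTopology_iff.1 ht
    exact ⟨I, rfl⟩
  · rintro ⟨I, rfl⟩
    exact ⟨_, isClosed_zariskiTopology_iff.2 ⟨I, rfl⟩, rfl⟩

theorem isClosed_setOf_evalAt_eq_zero (p : MvPolynomial (Fin n × Fin n) K) :
    IsClosed {g : Matrix.SpecialLinearGroup (Fin n) K | evalAt g p = 0} := by
  refine isClosed_zariskiSL_iff.2 ⟨Ideal.span {p}, ?_⟩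
  ext g
  constructor
  · intro hg q hq
    obtain ⟨r, rfl⟩ := Ideal.mem_span_singleton'.1 hq
    rw [map_mul, show evalAt g p = 0 from hg, mul_zero]
  · exact fun hg => hg p (Ideal.mem_span_singleton_self p)

/-- A descending chain of closed sets gives an ascending chain of vanishing ideals in a Noetherian
polynomial ring. -/
instance : TopologicalSpace.NoetherianSpace (Matrix.SpecialLinearGroup (Fin n) K) := by
  refine ((TopologicalSpace.noetherianSpace_TFAE
    (Matrix.SpecialLinearGroup (Fin n) K)).out 0 1 :).2 ?_
  let f : TopologicalSpace.Closeds (Matrix.SpecialLinearGroup (Fin n) K) →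
      Ideal (MvPolynomial (Fin n × Fin n) K) := fun Z => ⨅ g ∈ Z, RingHom.ker (evalAt g)
  have hf : ∀ Z W, f W ≤ f Z → Z ≤ W := by
    intro Z W h g hg
    obtain ⟨I, hI⟩ := isClosed_zariskiSL_iff.1 W.isClosed
    change g ∈ (W : Set _)
    rw [hI]
    intro p hp
    have hpW : p ∈ f W := by
      simp only [f, Submodule.mem_iInf]
      intro k hk
      have : k ∈ (W : Set _) := hk
      rw [hI] at this
      exact this p hp
    have hpZ := h hpW
    simp only [f, Submodule.mem_iInf] at hpZ
    exact hpZ g hg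
  have hanti : StrictAnti f := fun Z W h =>
    ⟨iInf_le_iInf_of_subset h.le, fun h' => h.not_ge (hf _ _ h')⟩
  exact hanti.wellFoundedLT

/-- A self-map of `SL_n(K)` whose matrix entries are polynomials. -/
def IsPolyMap (φ : Matrix.SpecialLinearGroup (Fin n) K → Matrix.SpecialLinearGroup (Fin n) K) :
    Prop :=
  ∃ P : Matrix (Fin n) (Fin n) (MvPolynomial (Fin n × Fin n) K),
    ∀ g, P.map (evalAt g) = (φ g).1

theorem map_mvPolynomialX_evalAt (g : Matrix.SpecialLinearGroup (Fin n) K) :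
    (Matrix.mvPolynomialX (Fin n) (Fin n) K).map (evalAt g) = g.1 := by
  ext i j
  simp [evalAt]

theorem isPolyMap_id : IsPolyMap (K := K) (n := n) id :=
  ⟨_, map_mvPolynomialX_evalAt⟩

theorem isPolyMap_const (k : Matrix.SpecialLinearGroup (Fin n) K) : IsPolyMap fun _ => k :=
  ⟨k.1.map (algebraMap K _), fun g => by ext i j; simp⟩

theorem IsPolyMap.mul {φ ψ : Matrix.SpecialLinearGroup (Fin n) K →
    Matrix.SpecialLinearGroup (Fin n) K} (hφ : IsPolyMap φ) (hψ : IsPolyMap ψ) :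
    IsPolyMap fun g => φ g * ψ g := by
  obtain ⟨P, hP⟩ := hφ
  obtain ⟨Q, hQ⟩ := hψ
  exact ⟨P * Q, fun g => by rw [Matrix.map_mul, hP, hQ]; rfl⟩

theorem isPolyMap_inv : IsPolyMap (K := K) (n := n) fun g => g⁻¹ := by
  refine ⟨(Matrix.mvPolynomialX (Fin n) (Fin n) K).adjugate, fun g => ?_⟩
  have := RingHom.map_adjugate (evalAt g : _ →+* K) (Matrix.mvPolynomialX (Fin n) (Fin n) K)
  rw [RingHom.mapMatrix_apply, RingHom.mapMatrix_apply] at this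
  refine this.trans ?_
  rw [Matrix.SpecialLinearGroup.coe_inv]
  congr 1
  exact map_mvPolynomialX_evalAt g

theorem IsPolyMap.exists_pullback {φ : Matrix.SpecialLinearGroup (Fin n) K →
    Matrix.SpecialLinearGroup (Fin n) K} (hφ : IsPolyMap φ)
    (p : MvPolynomial (Fin n × Fin n) K) :
    ∃ q : MvPolynomial (Fin n × Fin n) K, ∀ g, evalAt g q = evalAt (φ g) p := by
  obtain ⟨P, hP⟩ := hφ
  refine ⟨aeval (fun ij => P ij.1 ij.2) p, fun g => ?_⟩
  rw [← AlgHom.comp_apply, comp_aeval, evalAt]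
  congr 2
  ext ij
  rw [← hP g]
  rfl

theorem IsPolyMap.continuous {φ : Matrix.SpecialLinearGroup (Fin n) K →
    Matrix.SpecialLinearGroup (Fin n) K} (hφ : IsPolyMap φ) : Continuous φ := by
  refine continuous_iff_isClosed.2 fun Z hZ => ?_
  obtain ⟨I, rfl⟩ := isClosed_zariskiSL_iff.1 hZ
  have : φ ⁻¹' {g | ∀ p ∈ I, evalAt g p = 0} = ⋂ p ∈ I, {g | evalAt (φ g) p = 0} := by
    ext g
    simp
  rw [this]
  refine isClosed_biInter fun p _ => ?_
  obtain ⟨q, hq⟩ := hφ.exists_pullback p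
  simp only [← hq]
  exact isClosed_setOf_evalAt_eq_zero q

instance : SeparatelyContinuousMul (Matrix.SpecialLinearGroup (Fin n) K) where
  continuous_const_mul := ((isPolyMap_const _).mul isPolyMap_id).continuous
  continuous_mul_const := (isPolyMap_id.mul (isPolyMap_const _)).continuous

instance : ContinuousInv (Matrix.SpecialLinearGroup (Fin n) K) where
  continuous_inv := isPolyMap_inv.continuous

instance (G : Subgroup (Matrix.SpecialLinearGroup (Fin n) K)) : SeparatelyContinuousMul G where
  continuous_const_mul := Continuous.subtype_mk
    (SeparatelyContinuousMul.continuous_const_mul.comp continuous_subtype_val) _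
  continuous_mul_const := Continuous.subtype_mk
    (SeparatelyContinuousMul.continuous_mul_const.comp continuous_subtype_val) _

instance (G : Subgroup (Matrix.SpecialLinearGroup (Fin n) K)) : ContinuousInv G where
  continuous_inv := Continuous.subtype_mk (continuous_inv.comp continuous_subtype_val) _

instance (G : Subgroup (Matrix.SpecialLinearGroup (Fin n) K)) :
    TopologicalSpace.NoetherianSpace G :=
  Topology.IsInducing.subtypeVal.noetherianSpace

/-- Every subgroup of `SL_n(K)` that is infinite contains an infinite irreducible subgroup. -/
theorem exists_infinite_irreducible_subgroup (L : Subgroup (Matrix.SpecialLinearGroup (Fin n) K))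
    [Infinite L] : ∃ H ≤ L, Infinite H ∧
      IsIrreducible (H : Set (Matrix.SpecialLinearGroup (Fin n) K)) := by
  refine ⟨(identityComponent L).map L.subtype, ?_, ?_, ?_⟩
  · rintro _ ⟨g, -, rfl⟩
    exact g.2
  · have hfin := finite_quotient_identityComponent (Γ := L)
    have hinf : Infinite (identityComponent L) := by
      by_contra h
      rw [not_infinite_iff_finite] at h
      have : Finite L := Finite.of_equiv _ (Subgroup.groupEquivQuotientProdSubgroup
        (s := identityComponent L)).symm
      exact not_finite L
    exact Infinite.of_injective _
      ((identityComponent L).equivMapOfInjective L.subtype L.subtype_injective).injective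
  · exact isIrreducible_identityComponent.image _ continuous_subtype_val.continuousOn

end ZariskiSL

/-! ### Regular functions, translations and the Nullstellensatz -/

section RegularFunctions

attribute [local instance] zariskiSL

variable {K : Type u} [Field K] {n : ℕ} (G : Subgroup (Matrix.SpecialLinearGroup (Fin n) K))

/-- Restriction of polynomial functions to `G`. -/
noncomputable def restrictPoly : MvPolynomial (Fin n × Fin n) K →ₐ[K] (G → K) :=
  AlgHom.pi fun g => evalAt g.1

/-- The algebra of regular functions on `G`. -/
noncomputable abbrev regularFunctions : Subalgebra K (G → K) :=
  (restrictPoly G).range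

variable {G}

theorem entry_mem (i j : Fin n) : (fun g : G => g.1.1 i j) ∈ regularFunctions G :=
  ⟨X (i, j), by ext g; exact aeval_X _ _⟩

theorem regularFunctions_ext {g h : G} (hgh : ∀ f : regularFunctions G, f.1 g = f.1 h) :
    g = h := by
  apply Subtype.ext
  ext i j
  exact hgh ⟨_, entry_mem i j⟩

instance : Algebra.FiniteType K (regularFunctions G) :=
  Algebra.FiniteType.of_surjective (restrictPoly G).rangeRestrict
    (AlgHom.rangeRestrict_surjective _)

theorem isDomain_regularFunctions (hG : IsIrreducible (G : Set (Matrix.SpecialLinearGroup (Fin n) K))) :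
    IsDomain (regularFunctions G) := by
  have : NoZeroDivisors (regularFunctions G) := by
    refine ⟨fun {a b} hab => ?_⟩
    obtain ⟨p, hp⟩ := a.2
    obtain ⟨q, hq⟩ := b.2
    rcases isPreirreducible_iff_isClosed_union_isClosed.1 hG.2 _ _
      (isClosed_setOf_evalAt_eq_zero p) (isClosed_setOf_evalAt_eq_zero q) (by
        intro g hg
        have h1 := congrFun (congrArg Subtype.val hab) ⟨g, hg⟩
        have h2 : evalAt g p * evalAt g q = 0 := by
          rw [← show a.1 ⟨g, hg⟩ = evalAt g p from (congrFun hp ⟨g, hg⟩).symm,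
            ← show b.1 ⟨g, hg⟩ = evalAt g q from (congrFun hq ⟨g, hg⟩).symm]
          exact h1
        exact mul_eq_zero.1 h2) with h | h
    · left
      ext g
      exact (congrFun hp g).symm.trans (h g.2)
    · right
      ext g
      exact (congrFun hq g).symm.trans (h g.2)
  exact NoZeroDivisors.to_isDomain _

/-- Composition of regular functions with a polynomial map. -/
noncomputable def pullback (φ : G → G)
    (hφ : ∃ ψ : Matrix.SpecialLinearGroup (Fin n) K → Matrix.SpecialLinearGroup (Fin n) K,
      IsPolyMap ψ ∧ ∀ g : G, ψ g = φ g) : regularFunctions G →ₐ[K] regularFunctions G where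
  toFun f := ⟨fun g => f.1 (φ g), by
    obtain ⟨ψ, hψ, h⟩ := hφ
    obtain ⟨p, hp⟩ := f.2
    obtain ⟨q, hq⟩ := hψ.exists_pullback p
    refine ⟨q, funext fun g => ?_⟩
    rw [← hp]
    exact (hq g).trans (by rw [h]; rfl)⟩
  map_one' := rfl
  map_mul' _ _ := rfl
  map_zero' := rfl
  map_add' _ _ := rfl
  commutes' _ := rfl

/-- The map `g ↦ g x g⁻¹` on regular functions. -/
noncomputable def conjPullback (x : G) : regularFunctions G →ₐ[K] regularFunctions G :=
  pullback (fun g => g * x * g⁻¹)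
    ⟨_, (isPolyMap_id.mul (isPolyMap_const x.1)).mul isPolyMap_inv, fun _ => rfl⟩

theorem conjPullback_apply (x : G) (f : regularFunctions G) (g : G) :
    (conjPullback x f).1 g = f.1 (g * x * g⁻¹) := rfl

/-- Left translation of regular functions. -/
noncomputable def leftTranslation (k : G) : regularFunctions G ≃ₐ[K] regularFunctions G :=
  AlgEquiv.ofAlgHom
    (pullback (fun g => k * g) ⟨_, (isPolyMap_const k.1).mul isPolyMap_id, fun _ => rfl⟩)
    (pullback (fun g => k⁻¹ * g) ⟨_, (isPolyMap_const k⁻¹.1).mul isPolyMap_id, fun _ => rfl⟩)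
    (by
      ext f g
      exact congrArg f.1 (inv_mul_cancel_left k g))
    (by
      ext f g
      exact congrArg f.1 (mul_inv_cancel_left k g))

theorem leftTranslation_apply (k : G) (f : regularFunctions G) (g : G) :
    (leftTranslation k f).1 g = f.1 (k * g) := rfl

/-- Right translation of regular functions. -/
noncomputable def rightTranslation (k : G) : regularFunctions G ≃ₐ[K] regularFunctions G :=
  AlgEquiv.ofAlgHom
    (pullback (fun g => g * k) ⟨_, isPolyMap_id.mul (isPolyMap_const k.1), fun _ => rfl⟩)
    (pullback (fun g => g * k⁻¹) ⟨_, isPolyMap_id.mul (isPolyMap_const k⁻¹.1), fun _ => rfl⟩)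
    (by
      ext f g
      exact congrArg f.1 (mul_inv_cancel_right g k))
    (by
      ext f g
      exact congrArg f.1 (inv_mul_cancel_right g k))

theorem rightTranslation_apply (k : G) (f : regularFunctions G) (g : G) :
    (rightTranslation k f).1 g = f.1 (g * k) := rfl

/-- The maximal ideal of regular functions vanishing at a point. -/
noncomputable def pointIdeal (g : G) : Ideal (regularFunctions G) :=
  RingHom.ker ((Pi.evalAlgHom K (fun _ : G => K) g).comp (regularFunctions G).val)

theorem mem_pointIdeal {g : G} {f : regularFunctions G} : f ∈ pointIdeal g ↔ f.1 g = 0 := Iff.rfl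

instance (g : G) : (pointIdeal g).IsMaximal :=
  RingHom.ker_isMaximal_of_surjective _ fun c => ⟨algebraMap K _ c, rfl⟩

/-- The **Nullstellensatz** for closed linear groups. -/
theorem exists_eq_pointIdeal [IsAlgClosed K]
    (hG : IsClosed (G : Set (Matrix.SpecialLinearGroup (Fin n) K)))
    (m : Ideal (regularFunctions G)) [hm : m.IsMaximal] : ∃ g, m = pointIdeal g := by
  let π := (restrictPoly G).rangeRestrict
  have hπ : Function.Surjective π := AlgHom.rangeRestrict_surjective _
  have hmax : (m.comap π).IsMaximal := Ideal.comap_isMaximal_of_surjective π hπ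
  obtain ⟨x, hx⟩ := (isMaximal_iff_eq_vanishingIdeal_singleton).1 hmax
  -- Applied to `det - 1` this puts `x` in `SL_n(K)`; applied to the equations of the closed set `G`
  -- it puts `x` in `G`.
  have hzero : ∀ p, (∀ g : G, evalAt g.1 p = 0) → aeval x p = 0 := by
    intro p hp
    have h : p ∈ m.comap π := by
      rw [Ideal.mem_comap, show π p = 0 from Subtype.ext (funext hp)]
      exact zero_mem _
    rw [hx] at h
    exact mem_vanishingIdeal_iff.1 h x rfl
  have hmap : ∀ y : Fin n × Fin n → K, (aeval y (Matrix.mvPolynomialX (Fin n) (Fin n) K).det) =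
      (Matrix.of fun i j => y (i, j)).det := by
    intro y
    rw [AlgHom.map_det]
    congr 1
    ext i j
    simp
  have hdet : (Matrix.of fun i j => x (i, j)).det = 1 := by
    have := hzero ((Matrix.mvPolynomialX (Fin n) (Fin n) K).det - 1) (fun g => by
      rw [map_sub, map_one, evalAt, hmap, sub_eq_zero]
      exact g.1.2)
    rwa [map_sub, map_one, hmap, sub_eq_zero] at this
  let g : Matrix.SpecialLinearGroup (Fin n) K := ⟨_, hdet⟩
  obtain ⟨I, hI⟩ := isClosed_zariskiSL_iff.1 hG
  have hg : g ∈ (G : Set (Matrix.SpecialLinearGroup (Fin n) K)) := by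
    rw [hI]
    intro p hp
    refine hzero p fun k => ?_
    have hk : k.1 ∈ (G : Set (Matrix.SpecialLinearGroup (Fin n) K)) := k.2
    rw [hI] at hk
    exact hk p hp
  refine ⟨⟨g, hg⟩, hm.eq_of_le Ideal.IsPrime.ne_top' fun f hf => ?_⟩
  obtain ⟨p, rfl⟩ := hπ f
  have h : p ∈ m.comap π := hf
  rw [hx] at h
  exact mem_vanishingIdeal_iff.1 h x rfl

theorem ringKrullDim_regularFunctions :
    ringKrullDim (regularFunctions G) = ringKrullDim (CoordinateRing (points G)) := by
  have hker : RingHom.ker (restrictPoly G).rangeRestrict = vanishingIdeal K (points G) := by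
    ext p
    rw [AlgHom.ker_rangeRestrict, RingHom.mem_ker, mem_vanishingIdeal_iff]
    constructor
    · rintro h x ⟨g, hg, hx⟩
      have := congrFun h ⟨g, hg⟩
      rw [show x = fun p => g.1 p.1 p.2 from funext fun p => hx p.1 p.2]
      exact this
    · exact fun h => funext fun g => h _ ⟨g, g.2, fun _ _ => rfl⟩
  exact (ringKrullDim_eq_of_ringEquiv ((Ideal.quotEquivOfEq hker.symm).trans
    (RingHom.quotientKerEquivOfSurjective
      (AlgHom.rangeRestrict_surjective (restrictPoly G))))).symm

end RegularFunctions

/-! ### From the affine variety to the group -/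

section CoordinateRing

attribute [local instance] zariskiSL

variable {K : Type*} [Field K] {n : ℕ} {G : Subgroup (Matrix.SpecialLinearGroup (Fin n) K)}

theorem points_eq_image : points G = (fun g p => g.1 p.1 p.2) ''
    (G : Set (Matrix.SpecialLinearGroup (Fin n) K)) := by
  ext x
  constructor
  · rintro ⟨g, hg, hx⟩
    exact ⟨g, hg, funext fun p => (hx p.1 p.2).symm⟩
  · rintro ⟨g, hg, rfl⟩
    exact ⟨g, hg, fun _ _ => rfl⟩

theorem injective_coordinates : Function.Injective
    fun (g : Matrix.SpecialLinearGroup (Fin n) K) (p : Fin n × Fin n) => g.1 p.1 p.2 := by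
  intro g h hgh
  ext i j
  exact congrFun hgh (i, j)

theorem IsLinearAlgebraicGroup.isClosed (hG : IsLinearAlgebraicGroup G) :
    IsClosed (G : Set (Matrix.SpecialLinearGroup (Fin n) K)) := by
  rw [@isClosed_induced_iff _ _ (zariskiTopology (Fin n × Fin n) K)]
  refine ⟨points G, hG, ?_⟩
  rw [points_eq_image, Set.preimage_image_eq _ injective_coordinates]

theorem IsZariskiConnected.isIrreducible (hG : IsZariskiConnected G) :
    IsIrreducible (G : Set (Matrix.SpecialLinearGroup (Fin n) K)) := by
  have hind : @Topology.IsInducing _ _ zariskiSL (zariskiTopology (Fin n × Fin n) K)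
    fun (g : Matrix.SpecialLinearGroup (Fin n) K) p => g.1 p.1 p.2 := by
    let _ := zariskiTopology (Fin n × Fin n) K
    exact ⟨rfl⟩
  have hpre : IsPreconnected (G : Set (Matrix.SpecialLinearGroup (Fin n) K)) := by
    let _ := zariskiTopology (Fin n × Fin n) K
    rw [← hind.isPreconnected_image, ← points_eq_image]
    exact hG.isPreconnected
  have : ConnectedSpace G := isConnected_iff_connectedSpace.1 ⟨⟨1, one_mem G⟩, hpre⟩
  have h := (isIrreducible_univ_of_connected (Γ := G)).image _ continuous_subtype_val.continuousOn
  rwa [Set.image_univ, Subtype.range_coe] at h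

theorem ringKrullDim_le_dim (hG : IsIrreducible (G : Set (Matrix.SpecialLinearGroup (Fin n) K))) :
    ringKrullDim (CoordinateRing (points G)) ≤ dim (points G) := by
  have hirr : @IsIrreducible _ (zariskiTopology (Fin n × Fin n) K) (points G) := by
    let _ := zariskiTopology (Fin n × Fin n) K
    rw [points_eq_image]
    exact hG.image _ continuous_induced_dom.continuousOn
  exact le_iSup (fun Z : {Z // IsIrredComponent (points G) Z} =>
    ringKrullDim (CoordinateRing Z.1)) ⟨points G, ⟨subset_rfl, hirr⟩, fun Y hY _ => hY.1⟩

end CoordinateRing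

/-! ### Dimension drop and finite fibres -/

open Module

/-- A nonzero kernel element of a domain is a nonzerodivisor, and dividing by it already lowers the
dimension. -/
theorem ringKrullDim_succ_le_of_surjective {R S : Type*} [CommRing R] [IsDomain R] [CommRing S]
    (φ : R →+* S) (hφ : Function.Surjective φ) (hinj : ¬ Function.Injective φ) :
    ringKrullDim S + 1 ≤ ringKrullDim R := by
  rw [injective_iff_map_eq_zero] at hinj
  push Not at hinj
  obtain ⟨r, hr, hr0⟩ := hinj
  have hle : ∀ a ∈ Ideal.span {r}, φ a = 0 := by
    intro a ha
    obtain ⟨b, rfl⟩ := Ideal.mem_span_singleton'.1 ha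
    rw [map_mul, hr, mul_zero]
  exact (add_le_add_left (ringKrullDim_le_of_surjective (Ideal.Quotient.lift _ φ hle)
    (Ideal.Quotient.lift_surjective_of_surjective _ hle hφ)) 1).trans
    (ringKrullDim_quotient_succ_le_of_nonZeroDivisor (mem_nonZeroDivisors_of_ne_zero hr0))

theorem ringKrullDim_range_succ_le {K R S : Type*} [CommRing K] [CommRing R] [IsDomain R]
    [CommRing S] [Algebra K R] [Algebra K S] (φ : R →ₐ[K] S) (hφ : ¬ Function.Injective φ) :
    ringKrullDim φ.range + 1 ≤ ringKrullDim R :=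
  ringKrullDim_succ_le_of_surjective φ.rangeRestrict.toRingHom φ.rangeRestrict_surjective
    fun h => hφ fun _ _ hab => h (Subtype.ext hab)

theorem le_of_add_one_le {a : WithBot ℕ∞} {m : ℕ} (h : a + 1 ≤ ((m + 1 : ℕ) : WithBot ℕ∞)) :
    a ≤ (m : WithBot ℕ∞) := by
  induction a with
  | bot => exact bot_le
  | coe a =>
    have h1 : a + 1 ≤ ((m + 1 : ℕ) : ℕ∞) := by exact_mod_cast h
    have h2 : a ≤ (m : ℕ∞) := by
      push_cast at h1
      exact (ENat.add_le_add_iff_right ENat.one_ne_top).1 h1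
    exact_mod_cast h2

/-- Such a domain is a field, finite over `K` by Zariski's lemma. -/
theorem exists_algebraMap_eq_of_ringKrullDim_le_zero {K A : Type*} [Field K] [IsAlgClosed K]
    [CommRing A] [IsDomain A] [Algebra K A] [Algebra.FiniteType K A] (h : ringKrullDim A ≤ 0)
    (a : A) : ∃ c, algebraMap K A c = a := by
  have : Ring.KrullDimLE 0 A := Ring.krullDimLE_iff.2 h
  let _ : Field A := Ring.KrullDimLE.isField_of_isDomain.toField
  have : Module.Finite K A := finite_of_finite_type_of_isJacobsonRing K A
  exact (Algebra.IsIntegral.isIntegral (R := K) a).exists_algebraMap_eq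

/-- If a noninjective endomorphism of an algebra of dimension at most two has a finite fibre
through a prime, then that prime has height at most one. -/
theorem height_le_one_of_finite_fiber {K R : Type*} [Field K] [CommRing R] [IsDomain R]
    [Algebra K R] [Algebra.FiniteType K R] (hdim : ringKrullDim R ≤ 2) (φ : R →ₐ[K] R)
    (hφ : ¬ Function.Injective φ) (P : Ideal R) [P.IsPrime] {C : Type*} [Finite C] (M : C → Ideal R)
    (hmax : ∀ c, (M c).IsMaximal)
    (hM : ∀ m : Ideal R, m.IsMaximal → (∀ f, φ f ∈ P → φ f ∈ m) → ∃ c, m = M c) :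
    P.height ≤ 1 := by
  have hA : ringKrullDim φ.range ≤ 1 := le_of_add_one_le (m := 1)
    ((ringKrullDim_range_succ_le φ hφ).trans (by simpa using hdim))
  have : Algebra.FiniteType K φ.range :=
    Algebra.FiniteType.of_surjective _ φ.rangeRestrict_surjective
  have : IsNoetherianRing φ.range := Algebra.FiniteType.isNoetherianRing K φ.range
  have : IsNoetherianRing R := Algebra.FiniteType.isNoetherianRing K R
  have : IsJacobsonRing R := isJacobsonRing_of_finiteType (A := K)
  let p : Ideal φ.range := P.under φ.range
  let J : Ideal R := p.map (algebraMap φ.range R)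
  have hJ : ∀ m : Ideal R, m.IsMaximal → J ≤ m → ∃ c, m = M c := fun m hm hJm =>
    hM m hm fun f hf => hJm (Ideal.mem_map_of_mem (algebraMap φ.range R)
      (x := (⟨φ f, f, rfl⟩ : φ.range)) hf)
  -- `J` cuts out the fibre. In a Jacobson ring a prime over `J` is an intersection of maximal
  -- ideals, here finitely many, so it contains and equals one of them.
  have hprime : ∀ q : Ideal R, q.IsPrime → J ≤ q → q.IsMaximal := by
    intro q hq hJq
    have := Fintype.ofFinite C
    have hle : Finset.univ.inf M ≤ q := by
      rw [← IsJacobsonRing.out ‹_› hq.isRadical]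
      refine le_sInf fun m ⟨hqm, hm⟩ => ?_
      obtain ⟨c, rfl⟩ := hJ m hm (hJq.trans hqm)
      exact Finset.inf_le (Finset.mem_univ c)
    obtain ⟨c, -, hc⟩ := hq.inf_le'.1 hle
    exact (hmax c).eq_of_le hq.ne_top hc ▸ hmax c
  have hquot : Ring.KrullDimLE 0 (R ⧸ J) := by
    refine Ring.krullDimLE_zero_iff.2 fun I hI => ?_
    have hm := hprime (I.comap (Ideal.Quotient.mk J)) inferInstance
      (fun f hf => by
        rw [Ideal.mem_comap, Ideal.Quotient.eq_zero_iff_mem.2 hf]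
        exact zero_mem _)
    have hs := Ideal.Quotient.mk_surjective (I := J)
    rcases Ideal.map_eq_top_or_isMaximal_of_surjective _ hs hm with h | h
    · rw [Ideal.map_comap_of_surjective _ hs] at h
      exact absurd h hI.ne_top
    · rwa [Ideal.map_comap_of_surjective _ hs] at h
  have hJP : J ≤ P := Ideal.map_comap_le
  have hPmap : (P.map (Ideal.Quotient.mk J)).IsPrime :=
    Ideal.map_isPrime_of_surjective Ideal.Quotient.mk_surjective (by rwa [Ideal.mk_ker])
  have h2 : (P.map (Ideal.Quotient.mk J)).height ≤ 0 := by
    have := (Ideal.height_le_ringKrullDim_of_ne_top hPmap.ne_top).trans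
      (Ring.krullDimLE_iff.1 hquot)
    exact_mod_cast this
  have h1 : p.height ≤ 1 := by
    have := (Ideal.height_le_ringKrullDim_of_ne_top (I := p) Ideal.IsPrime.ne_top').trans hA
    exact_mod_cast this
  -- The height of `P` is at most that of `p` in the image, of dimension at most one, plus that of
  -- `P` in the zero-dimensional fibre.
  exact (Ideal.height_le_height_add_of_liesOver p P).trans
    ((add_le_add h1 h2).trans (add_zero 1).le)

/-! ### Matrix coefficients and characteristic polynomials -/

section Action

variable {K : Type u} [Field K] {n : ℕ} (G : Subgroup (Matrix.SpecialLinearGroup (Fin n) K))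

/-- The action of a linear group on column vectors. -/
noncomputable def matrixAction : G →* End K (Fin n → K) where
  toFun g := Matrix.toLinAlgEquiv' g.1.1
  map_one' := map_one _
  map_mul' _ _ := map_mul _ _ _

variable {G}

theorem matrixAction_apply (g : G) (v : Fin n → K) : matrixAction G g v = g.1.1.mulVec v := rfl

theorem injective_matrixAction : Function.Injective (matrixAction G) := by
  intro g h hgh
  exact Subtype.ext (Subtype.ext (Matrix.toLinAlgEquiv'.injective hgh))

theorem dual_matrixAction (ξ : Dual K (Fin n → K)) (v : Fin n → K) (g : G) :
    ξ (matrixAction G g v) = ∑ i, ∑ j, (ξ (Pi.single i 1) * v j) * g.1.1 i j := by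
  rw [matrixAction_apply, LinearMap.pi_apply_eq_sum_univ ξ]
  refine Finset.sum_congr rfl fun i _ => ?_
  rw [Matrix.mulVec, dotProduct, smul_eq_mul, Finset.sum_mul]
  refine Finset.sum_congr rfl fun j _ => ?_
  have : (fun k => if i = k then (1 : K) else 0) = Pi.single i 1 := by
    ext k
    simp [Pi.single_apply, eq_comm]
  rw [this]
  ring

theorem dual_matrixAction_mem (ξ : Dual K (Fin n → K)) (v : Fin n → K) :
    (fun g : G => ξ (matrixAction G g v)) ∈ regularFunctions G := by
  have : (fun g : G => ξ (matrixAction G g v)) =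
      ∑ i, ∑ j, (ξ (Pi.single i 1) * v j) • fun g : G => g.1.1 i j := by
    ext g
    simp [dual_matrixAction]
  rw [this]
  exact Subalgebra.sum_mem _ fun i _ => Subalgebra.sum_mem _ fun j _ =>
    Subalgebra.smul_mem _ (entry_mem i j) _

theorem charpoly_coeff_mem (k : ℕ) :
    (fun g : G => g.1.1.charpoly.coeff k) ∈ regularFunctions G := by
  refine ⟨(Matrix.mvPolynomialX (Fin n) (Fin n) K).charpoly.coeff k, ?_⟩
  ext g
  have h := Matrix.charpoly_map (Matrix.mvPolynomialX (Fin n) (Fin n) K) (evalAt g.1 : _ →+* K)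
  rw [show (Matrix.mvPolynomialX (Fin n) (Fin n) K).map (evalAt g.1 : _ →+* K) = g.1.1 from
    map_mvPolynomialX_evalAt g.1] at h
  rw [h, Polynomial.coeff_map]
  rfl

end Action

/-! ### Dense conjugacy classes and dimension one -/

section Conjugation

variable {K : Type u} [Field K] {n : ℕ} {G : Subgroup (Matrix.SpecialLinearGroup (Fin n) K)}

theorem mul_comm_of_forall_conj_const {x : G}
    (h : ∀ i j, ∃ c, ∀ g : G, (g * x * g⁻¹).1.1 i j = c) (g : G) : g * x = x * g := by
  rw [← mul_inv_eq_iff_eq_mul]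
  ext i j
  obtain ⟨c, hc⟩ := h i j
  have h1 := hc 1
  rw [one_mul, inv_one, mul_one] at h1
  exact (hc g).trans h1.symm

/-- If the conjugacy class of an element is dense, then the group is trivial. -/
theorem eq_one_of_injective_conjPullback [IsAlgClosed K] {x : G}
    (hx : Function.Injective (conjPullback x)) (g : G) : g = 1 := by
  -- Density of the class: a regular function constant on it is constant on `G`.
  have hconst : ∀ f ∈ regularFunctions G, ∀ c, (∀ g : G, f (g * x * g⁻¹) = c) → ∀ g, f g = c := by
    intro f hf c hc g
    have : (⟨f, hf⟩ : regularFunctions G) = algebraMap K _ c :=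
      hx (Subtype.ext (funext fun g => hc g))
    exact congrFun (congrArg Subtype.val this) g
  have hchar : ∀ g : G, g.1.1.charpoly = x.1.1.charpoly := by
    intro g
    ext k
    refine hconst _ (charpoly_coeff_mem k) _ (fun g => ?_) g
    have h1 : (g * x * g⁻¹).1.1 = g.1.1 * x.1.1 * (g⁻¹).1.1 := rfl
    have h2 : (g⁻¹).1.1 * g.1.1 = 1 := congrArg (fun g : G => g.1.1) (inv_mul_cancel g)
    change (g * x * g⁻¹).1.1.charpoly.coeff k = _
    rw [h1, Matrix.charpoly_mul_comm, ← mul_assoc, h2, one_mul]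
  have hnil : ∀ g : G, IsNilpotent (matrixAction G g - 1) := by
    intro g
    refine ⟨n, ?_⟩
    have h1 := g.1.1.aeval_self_charpoly
    rw [hchar g, ← hchar 1, show (1 : G).1.1 = 1 from rfl, Matrix.charpoly_one, map_pow, map_sub,
      Polynomial.aeval_X, map_one, Fintype.card_fin] at h1
    change (Matrix.toLinAlgEquiv' g.1.1 - 1) ^ n = 0
    rw [← map_one Matrix.toLinAlgEquiv', ← map_sub, ← map_pow, h1, map_zero]
  let U : Submodule K (Fin n → K) := ⨅ g : G, LinearMap.ker (matrixAction G g - 1)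
  have hU : ∀ v, v ∈ U ↔ ∀ g, matrixAction G g v = v := by
    intro v
    simp [U, Submodule.mem_iInf, sub_eq_zero]
  suffices htop : U = ⊤ by
    apply injective_matrixAction
    rw [map_one]
    exact LinearMap.ext fun v => (hU v).1 (htop ▸ Submodule.mem_top) g
  by_contra hne
  have : Nontrivial ((Fin n → K) ⧸ U) := Submodule.Quotient.nontrivial_iff.2 hne
  have hinv : ∀ g, ∀ u ∈ U, matrixAction G g u ∈ U := fun g u hu => by rwa [(hU u).1 hu g]
  -- Kolchin's theorem is used modulo the space `U` of fixed vectors, in order to produce a vector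
  -- fixed modulo `U` that turns out to be fixed.
  obtain ⟨w, hw0, hw⟩ := exists_fixed_vector_of_unipotent (quotientEnd (matrixAction G) U hinv) (by
    intro g
    obtain ⟨k, hk⟩ := hnil g
    refine ⟨k, ?_⟩
    have hpow : ∀ (m : ℕ) v, ((quotientEnd (matrixAction G) U hinv g - 1) ^ m) (U.mkQ v) =
        U.mkQ (((matrixAction G g - 1) ^ m) v) := by
      intro m
      induction m with
      | zero => intro v; rfl
      | succ m ih =>
        intro v
        rw [pow_succ, pow_succ, End.mul_apply, End.mul_apply, ← ih]
        rfl
    refine LinearMap.ext fun w => ?_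
    obtain ⟨v, rfl⟩ := U.mkQ_surjective w
    rw [hpow, hk]
    simp)
  obtain ⟨v, rfl⟩ := U.mkQ_surjective w
  have hvU : v ∉ U := fun h => hw0 ((Submodule.Quotient.mk_eq_zero _).2 h)
  have hdiff : ∀ g, matrixAction G g v - v ∈ U := fun g => by
    rw [← Submodule.Quotient.mk_eq_zero, Submodule.Quotient.mk_sub, sub_eq_zero]
    exact hw g
  -- As `G` fixes `U`, the map `g ↦ g v - v` is a homomorphism to an additive group. It is constant
  -- on the class of `x`, hence on `G`, hence zero.
  have hadd : ∀ a b, matrixAction G (a * b) v - v =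
      (matrixAction G a v - v) + (matrixAction G b v - v) := by
    intro a b
    have h := (hU _).1 (hdiff b) a
    rw [map_sub] at h
    rw [map_mul, End.mul_apply, ← h]
    abel
  have hone : matrixAction G 1 v - v = 0 := by simp
  have hconj : ∀ g, matrixAction G (g * x * g⁻¹) v = matrixAction G x v := by
    intro g
    have h := hadd g g⁻¹
    rw [mul_inv_cancel, hone] at h
    have h2 := hadd (g * x) g⁻¹
    rw [hadd g x, add_right_comm, ← h, zero_add] at h2
    exact sub_left_inj.1 h2
  have hall : ∀ g i, matrixAction G g v i = matrixAction G x v i := fun g i =>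
    hconst _ (dual_matrixAction_mem (LinearMap.proj i) v) _
      (fun g => congrFun (hconj g) i) g
  refine hvU ((hU v).2 fun g => ?_)
  have h1 : matrixAction G g v = matrixAction G 1 v := by
    ext i
    rw [hall g, hall 1]
  rw [h1, map_one]
  rfl

/-- An irreducible group of dimension at most one is commutative. -/
theorem mul_comm_of_ringKrullDim_le_one [IsAlgClosed K] [IsDomain (regularFunctions G)]
    (hdim : ringKrullDim (regularFunctions G) ≤ 1) (g x : G) : g * x = x * g := by
  by_cases hx : Function.Injective (conjPullback x)
  · rw [eq_one_of_injective_conjPullback hx g, one_mul, mul_one]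
  have hsurj : Function.Surjective (conjPullback x).rangeRestrict :=
    AlgHom.rangeRestrict_surjective _
  have : Algebra.FiniteType K (conjPullback x).range := Algebra.FiniteType.of_surjective _ hsurj
  -- A class that is not dense has dimension zero, so the entries of `g x g⁻¹` are constant.
  have h0 : ringKrullDim (conjPullback x).range ≤ 0 :=
    le_of_add_one_le (m := 0) ((ringKrullDim_range_succ_le _ hx).trans (by simpa using hdim))
  refine mul_comm_of_forall_conj_const (fun i j => ?_) g
  obtain ⟨c, hc⟩ := exists_algebraMap_eq_of_ringKrullDim_le_zero (K := K) h0
    ((conjPullback x).rangeRestrict ⟨_, entry_mem i j⟩)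
  refine ⟨c, fun g => ?_⟩
  exact (congrFun (congrArg (fun f => f.1.1) hc) g).symm

theorem comap_leftTranslation_pointIdeal (g : G) :
    (pointIdeal (1 : G)).comap (leftTranslation g : regularFunctions G ≃+* regularFunctions G) =
      pointIdeal g := by
  ext f
  rw [Ideal.mem_comap, mem_pointIdeal, mem_pointIdeal]
  change f.1 (g * 1) = 0 ↔ _
  rw [mul_one]

end Conjugation

/-! ### Infinite centralizers in dimension two -/

section Centralizer

attribute [local instance] zariskiSL

variable {K : Type u} [Field K] [IsAlgClosed K] {n : ℕ}
  {G : Subgroup (Matrix.SpecialLinearGroup (Fin n) K)}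

/-- In a closed irreducible group of dimension at most two, an element whose conjugacy class is not
dense has an infinite centralizer, unless the group is commutative. -/
theorem infinite_centralizer (hG : IsClosed (G : Set (Matrix.SpecialLinearGroup (Fin n) K)))
    [IsDomain (regularFunctions G)] (hdim : ringKrullDim (regularFunctions G) ≤ 2) {x : G}
    (hx : ¬ Function.Injective (conjPullback x)) (hnc : ∃ a b : G, a * b ≠ b * a) :
    Infinite (Subgroup.centralizer {x}) := by
  by_contra hfin
  rw [not_infinite_iff_finite] at hfin
  obtain ⟨a, b, hab⟩ := hnc
  refine hab (mul_comm_of_ringKrullDim_le_one ?_ a b)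
  -- The fibre of the class map through `1` is the centralizer, assumed finite.
  have hP : (pointIdeal (1 : G)).height ≤ 1 := by
    refine height_le_one_of_finite_fiber hdim (conjPullback x) hx _
      (fun c : Subgroup.centralizer {x} => pointIdeal c.1) (fun _ => inferInstance)
      fun m hm hle => ?_
    obtain ⟨g, rfl⟩ := exists_eq_pointIdeal hG m
    refine ⟨⟨g, ?_⟩, rfl⟩
    rw [Subgroup.mem_centralizer_singleton_iff, ← mul_inv_eq_iff_eq_mul]
    refine regularFunctions_ext fun f => ?_
    have h : f.1 (g * x * g⁻¹) - f.1 x = 0 := hle (f - algebraMap K _ (f.1 x)) (by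
      change f.1 (1 * x * 1⁻¹) - f.1 x = 0
      simp)
    exact sub_eq_zero.1 h
  -- Translation carries the bound from `1` to every point.
  refine (ringKrullDim_le_iff_isMaximal_height_le 1).2 fun m hm => ?_
  obtain ⟨g, rfl⟩ := exists_eq_pointIdeal hG m
  rw [← comap_leftTranslation_pointIdeal, RingEquiv.height_comap]
  exact_mod_cast hP

end Centralizer

/-! ### Restriction to subgroups -/

section Restriction

variable {K : Type u} [Field K] {n : ℕ} {G H : Subgroup (Matrix.SpecialLinearGroup (Fin n) K)}

/-- Restriction of regular functions to a subgroup. -/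
noncomputable def restriction (h : H ≤ G) : regularFunctions G →ₐ[K] regularFunctions H where
  toFun f := ⟨fun g => f.1 ⟨g, h g.2⟩, by
    obtain ⟨p, hp⟩ := f.2
    refine ⟨p, funext fun g => ?_⟩
    rw [← hp]
    rfl⟩
  map_one' := rfl
  map_mul' _ _ := rfl
  map_zero' := rfl
  map_add' _ _ := rfl
  commutes' _ := rfl

theorem restriction_surjective (h : H ≤ G) : Function.Surjective (restriction h) := by
  rintro ⟨_, p, rfl⟩
  exact ⟨⟨_, p, rfl⟩, rfl⟩

/-- An irreducible subgroup of a two-dimensional irreducible group that centralizes a noncentral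
element is commutative. -/
theorem mul_comm_of_le_centralizer [IsAlgClosed K] [IsDomain (regularFunctions G)]
    [IsDomain (regularFunctions H)] (hdim : ringKrullDim (regularFunctions G) ≤ 2) (hHG : H ≤ G)
    {x : G} (hH : ∀ g : G, g.1 ∈ H → g * x = x * g) (hx : ∃ g : G, g * x ≠ x * g) (a b : H) :
    a * b = b * a := by
  refine mul_comm_of_ringKrullDim_le_one (le_of_add_one_le (m := 1)
    ((ringKrullDim_succ_le_of_surjective (restriction hHG).toRingHom (restriction_surjective hHG)
      fun hinj => ?_).trans (by simpa using hdim))) a b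
  -- The entries of `g x g⁻¹` are constant on `H`; were restriction injective, they would be
  -- constant on `G` and `x` would be central.
  obtain ⟨g, hg⟩ := hx
  refine hg (mul_comm_of_forall_conj_const (fun i j => ⟨x.1.1 i j, fun g => ?_⟩) g)
  have : conjPullback x ⟨_, entry_mem i j⟩ = algebraMap K _ (x.1.1 i j) := by
    refine hinj (Subtype.ext (funext fun k => ?_))
    have := hH ⟨k, hHG k.2⟩ k.2
    rw [← mul_inv_eq_iff_eq_mul] at this
    exact congrArg (fun g : G => g.1.1 i j) this
  exact congrFun (congrArg Subtype.val this) g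

end Restriction

theorem dualAnnihilator_dualCoannihilator {K V : Type*} [Field K] [AddCommGroup V] [Module K V]
    [FiniteDimensional K V] (Ξ : Submodule K (Dual K V)) :
    Ξ.dualCoannihilator.dualAnnihilator = Ξ :=
  Subspace.dualCoannihilator_dualAnnihilator_eq

theorem le_of_lt_add_one {a : WithBot ℕ∞} {m : ℕ} (h : a < ((m + 1 : ℕ) : WithBot ℕ∞)) :
    a ≤ (m : WithBot ℕ∞) := by
  induction a with
  | bot => exact bot_le
  | coe a =>
    have h1 : a < ((m + 1 : ℕ) : ℕ∞) := by exact_mod_cast h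
    lift a to ℕ using h1.ne_top
    have h2 : a < m + 1 := by exact_mod_cast h1
    exact_mod_cast Nat.lt_succ_iff.1 h2

/-! ### Functions from orbits and from conjugation -/

section Orbit

variable {K : Type u} [Field K] {n : ℕ} {G : Subgroup (Matrix.SpecialLinearGroup (Fin n) K)}

/-- The regular functions `g ↦ ξ (g v)` for a fixed vector `v`. -/
noncomputable def orbitFunction (v : Fin n → K) :
    Dual K (Fin n → K) →ₗ[K] regularFunctions G where
  toFun ξ := ⟨fun g => ξ (matrixAction G g v), dual_matrixAction_mem ξ v⟩
  map_add' _ _ := rfl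
  map_smul' _ _ := rfl

theorem orbitFunction_apply (v : Fin n → K) (ξ : Dual K (Fin n → K)) (g : G) :
    (orbitFunction v ξ).1 g = ξ (matrixAction G g v) := rfl

theorem leftTranslation_orbitFunction (v : Fin n → K) (ξ : Dual K (Fin n → K)) (g : G) :
    leftTranslation g (orbitFunction v ξ) = orbitFunction v (ξ ∘ₗ matrixAction G g) := by
  ext k
  rw [leftTranslation_apply, orbitFunction_apply, orbitFunction_apply, map_mul]
  rfl

/-- Modulo `U` the vector `v` is an eigenvector of `k`. The error stays in `U` after applying `g`,
and `ξ` kills it. -/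
theorem rightTranslation_orbitFunction {U : Submodule K (Fin n → K)}
    (hU : ∀ g : G, ∀ u ∈ U, matrixAction G g u ∈ U) {v : Fin n → K} {k : G} {c : K}
    (hk : matrixAction G k v - c • v ∈ U) {ξ : Dual K (Fin n → K)} (hξ : ξ ∈ U.dualAnnihilator) :
    rightTranslation k (orbitFunction v ξ) = c • orbitFunction v ξ := by
  ext g
  have h := (Submodule.mem_dualAnnihilator ξ).1 hξ _ (hU g _ hk)
  rw [map_sub, map_sub, map_smul, map_smul, sub_eq_zero] at h
  rw [rightTranslation_apply, orbitFunction_apply, map_mul]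
  exact h

theorem comp_mem_dualAnnihilator {U : Submodule K (Fin n → K)}
    (hU : ∀ g : G, ∀ u ∈ U, matrixAction G g u ∈ U) {ξ : Dual K (Fin n → K)}
    (hξ : ξ ∈ U.dualAnnihilator) (g : G) : ξ ∘ₗ matrixAction G g ∈ U.dualAnnihilator := by
  rw [Submodule.mem_dualAnnihilator] at hξ ⊢
  exact fun u hu => hξ _ (hU g u hu)

/-- The regular functions `g ↦ tr (A g x g⁻¹) + c`. -/
noncomputable def conjFunction (x : G) :
    (Matrix (Fin n) (Fin n) K × K) →ₗ[K] regularFunctions G where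
  toFun A := conjPullback x (∑ i, ∑ j, A.1 i j • ⟨_, entry_mem j i⟩) + algebraMap K _ A.2
  map_add' A B := by
    simp only [Prod.fst_add, Prod.snd_add, Matrix.add_apply, add_smul, Finset.sum_add_distrib,
      map_add]
    abel
  map_smul' c A := by
    ext g
    simp [conjPullback_apply, Finset.mul_sum, mul_assoc]

theorem conjFunction_apply (x : G) (A : Matrix (Fin n) (Fin n) K × K) (g : G) :
    (conjFunction x A).1 g = (A.1 * (g * x * g⁻¹).1.1).trace + A.2 := by
  simp [conjFunction, conjPullback_apply, Matrix.trace, Matrix.mul_apply]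

theorem leftTranslation_conjFunction (x g : G) (A : Matrix (Fin n) (Fin n) K × K) :
    leftTranslation g (conjFunction x A) =
      conjFunction x ((g⁻¹).1.1 * A.1 * g.1.1, A.2) := by
  ext k
  rw [leftTranslation_apply, conjFunction_apply, conjFunction_apply]
  have : (g * k * x * (g * k)⁻¹).1.1 = g.1.1 * (k * x * k⁻¹).1.1 * (g⁻¹).1.1 := by
    rw [mul_inv_rev]
    exact congrArg (fun g : G => g.1.1) (by group : g * k * x * (k⁻¹ * g⁻¹) =
      g * (k * x * k⁻¹) * g⁻¹)
  rw [this, ← mul_assoc, Matrix.trace_mul_comm]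
  simp only [mul_assoc]

theorem rightTranslation_conjFunction {x k : G} (hk : k * x = x * k)
    (A : Matrix (Fin n) (Fin n) K × K) :
    rightTranslation k (conjFunction x A) = conjFunction x A := by
  ext g
  rw [rightTranslation_apply, conjFunction_apply, conjFunction_apply]
  have : g * k * x * (g * k)⁻¹ = g * x * g⁻¹ := by
    rw [mul_assoc g k x, hk]
    group
  rw [this]

theorem conjFunction_single (x : G) (i j : Fin n) (g : G) :
    (conjFunction x (Matrix.single j i 1, 0)).1 g = (g * x * g⁻¹).1.1 i j := by
  rw [conjFunction_apply, add_zero, Matrix.trace_single_mul]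
  simp

theorem leftTranslation_one (f : regularFunctions G) : leftTranslation 1 f = f := by
  ext g
  rw [leftTranslation_apply, one_mul]

theorem leftTranslation_mem_iff {W : Submodule K (regularFunctions G)}
    (hW : ∀ g, ∀ f ∈ W, leftTranslation g f ∈ W) (g : G) (f : regularFunctions G) :
    leftTranslation g f ∈ W ↔ f ∈ W := by
  refine ⟨fun h => ?_, hW g f⟩
  have h1 := hW g⁻¹ _ h
  rwa [show leftTranslation g⁻¹ (leftTranslation g f) = f from Subtype.ext (funext fun k =>
    congrArg f.1 (mul_inv_cancel_left g k))] at h1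

/-- Left-invariant hyperplanes of a space of functions `g ↦ ξ (g v)`, `ξ ∈ U^⊥`, come from
invariant subspaces that contain `U` with codimension one. -/
theorem exists_larger_invariant_of_hyperplane {U : Submodule K (Fin n → K)}
    (hU : ∀ g : G, ∀ u ∈ U, matrixAction G g u ∈ U) (v : Fin n → K)
    {W : Submodule K (regularFunctions G)} (hW : ∀ g : G, ∀ f ∈ W, leftTranslation g f ∈ W)
    {ξ₀ : Dual K (Fin n → K)} (hξ₀ : ξ₀ ∈ U.dualAnnihilator) (hξ₀W : orbitFunction v ξ₀ ∉ W)
    (hplane : ∀ ξ ∈ U.dualAnnihilator, ∃ c : K, orbitFunction v ξ - c • orbitFunction v ξ₀ ∈ W) :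
    ∃ U' : Submodule K (Fin n → K), (∀ g : G, ∀ u ∈ U', matrixAction G g u ∈ U') ∧ U < U' ∧
      ∃ ξ : Dual K (Fin n → K), ∀ y ∈ U', y ∈ U ↔ ξ y = 0 := by
  -- The functionals in `U^⊥` whose orbit function lies in `W`; their common kernel is the enlarged
  -- subspace.
  let Ξ : Submodule K (Dual K (Fin n → K)) := U.dualAnnihilator ⊓ W.comap (orbitFunction v)
  have hmem : ∀ y, y ∈ Ξ.dualCoannihilator ↔ ∀ ξ ∈ Ξ, ξ y = 0 := fun y =>
    Submodule.mem_dualCoannihilator y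
  have hUmem : ∀ y, y ∈ U ↔ ∀ ξ ∈ U.dualAnnihilator, ξ y = 0 := fun y => by
    rw [← Submodule.mem_dualCoannihilator, Subspace.dualAnnihilator_dualCoannihilator_eq]
  refine ⟨Ξ.dualCoannihilator, fun g u hu => ?_, lt_of_le_of_ne ?_ ?_, ξ₀, fun y hy => ?_⟩
  · rw [hmem] at hu ⊢
    intro ξ hξ
    refine hu (ξ ∘ₗ matrixAction G g) ⟨comp_mem_dualAnnihilator hU hξ.1 g, ?_⟩
    change orbitFunction v _ ∈ W
    rw [← leftTranslation_orbitFunction]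
    exact hW g _ hξ.2
  · intro y hy
    rw [hmem]
    exact fun ξ hξ => (hUmem y).1 hy ξ hξ.1
  · intro h
    have h1 : ξ₀ ∈ Ξ := by
      rw [← dualAnnihilator_dualCoannihilator Ξ, ← h]
      exact hξ₀
    exact hξ₀W h1.2
  · rw [hUmem]
    refine ⟨fun h => h ξ₀ hξ₀, fun h ξ hξ => ?_⟩
    obtain ⟨c, hc⟩ := hplane ξ hξ
    have h1 : ξ - c • ξ₀ ∈ Ξ := by
      refine ⟨Submodule.sub_mem _ hξ (Submodule.smul_mem _ _ hξ₀), ?_⟩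
      change orbitFunction v _ ∈ W
      rw [map_sub, map_smul]
      exact hc
    have h2 := (hmem y).1 hy _ h1
    rw [LinearMap.sub_apply, LinearMap.smul_apply, h, smul_zero, sub_zero] at h2
    exact h2

end Orbit

/-! ### Invariant flags in dimension two -/

section Cover

attribute [local instance] zariskiSL

variable {K : Type u} [Field K] {n : ℕ} {G : Subgroup (Matrix.SpecialLinearGroup (Fin n) K)}

theorem isClosed_setOf_eq_zero (f : regularFunctions G) : IsClosed {g : G | f.1 g = 0} := by
  obtain ⟨_, p, rfl⟩ := f
  exact (isClosed_setOf_evalAt_eq_zero p).preimage continuous_subtype_val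

/-- The functionals with orbit function in `W'` are the annihilator of a set of vectors `w`, so the
condition on `g` is the vanishing of the matrix coefficients `ξ (g w)`. -/
theorem isClosed_setOf_leftTranslation_mem (v : Fin n → K)
    {V W W' : Submodule K (regularFunctions G)} (hV : V ≤ LinearMap.range (orbitFunction (G := G) v)) (hWV : W ≤ V) :
    IsClosed {g : G | ∀ u ∈ W, leftTranslation g u ∈ W'} := by
  let Ξ := W'.comap (orbitFunction (G := G) v)
  have : {g : G | ∀ u ∈ W, leftTranslation g u ∈ W'} =
      ⋂ ξ : W.comap (orbitFunction (G := G) v), ⋂ w : Ξ.dualCoannihilator,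
        {g : G | (orbitFunction w.1 ξ.1).1 g = 0} := by
    ext g
    simp only [Set.mem_iInter, Set.mem_ofPred_eq]
    constructor
    · intro hg ξ w
      have h := hg _ ξ.2
      rw [leftTranslation_orbitFunction] at h
      exact (Submodule.mem_dualCoannihilator _).1 w.2 (ξ.1 ∘ₗ matrixAction G g) h
    · intro hg u hu
      obtain ⟨ξ, rfl⟩ := hV (hWV hu)
      rw [leftTranslation_orbitFunction]
      change ξ ∘ₗ matrixAction G g ∈ Ξ
      rw [← dualAnnihilator_dualCoannihilator Ξ, Submodule.mem_dualAnnihilator]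
      exact fun w hw => hg ⟨ξ, hu⟩ ⟨w, hw⟩
  rw [this]
  exact isClosed_iInter fun ξ => isClosed_iInter fun w => isClosed_setOf_eq_zero _

theorem exists_forall_of_finite_cover
    (hG : IsIrreducible (G : Set (Matrix.SpecialLinearGroup (Fin n) K))) {ι : Type*} {s : Set ι}
    (hs : s.Finite) (Z : ι → Set G) (hZ : ∀ i ∈ s, IsClosed (Z i)) (hcov : ∀ g, ∃ i ∈ s, g ∈ Z i) :
    ∃ i ∈ s, ∀ g, g ∈ Z i := by
  have : IrreducibleSpace G := Subtype.irreducibleSpace hG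
  obtain ⟨z, hz, hsub⟩ := isIrreducible_iff_sUnion_isClosed.1
    (IrreducibleSpace.isIrreducible_univ G) (hs.image Z).toFinset (by
      intro z hz
      obtain ⟨i, hi, rfl⟩ := (Set.Finite.mem_toFinset _).1 hz
      exact hZ i hi) (by
      intro g _
      obtain ⟨i, hi, hg⟩ := hcov g
      exact ⟨Z i, by simpa using ⟨i, hi, rfl⟩, hg⟩)
  obtain ⟨i, hi, rfl⟩ := (Set.Finite.mem_toFinset _).1 hz
  exact ⟨i, hi, fun g => hsub trivial⟩

variable [IsAlgClosed K]

/-- The inductive step in the construction of an invariant flag of a group of dimension two. -/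
theorem exists_larger_invariant
    (hG : IsIrreducible (G : Set (Matrix.SpecialLinearGroup (Fin n) K)))
    [IsDomain (regularFunctions G)] (hdim : ringKrullDim (regularFunctions G) ≤ 2)
    {H : Subgroup (Matrix.SpecialLinearGroup (Fin n) K)} [Infinite H] (hHG : H ≤ G)
    (hcomm : ∀ a b : H, a * b = b * a) {x : G} (hH : ∀ g : G, g.1 ∈ H → g * x = x * g)
    (hx : ∃ g : G, g * x ≠ x * g) {U : Submodule K (Fin n → K)}
    (hU : ∀ g : G, ∀ u ∈ U, matrixAction G g u ∈ U) (hUtop : U ≠ ⊤) :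
    ∃ U' : Submodule K (Fin n → K), (∀ g : G, ∀ u ∈ U', matrixAction G g u ∈ U') ∧ U < U' ∧
      ∃ ξ : Dual K (Fin n → K), ∀ y ∈ U', y ∈ U ↔ ξ y = 0 := by
  by_contra hno
  obtain ⟨g₀, hg₀⟩ := hx
  have : Nontrivial ((Fin n → K) ⧸ U) := Submodule.Quotient.nontrivial_iff.2 hUtop
  obtain ⟨w, hw0, hw⟩ := exists_common_eigenvector
    ((quotientEnd (matrixAction G) U hU).comp (Subgroup.inclusion hHG)) hcomm
  obtain ⟨v, rfl⟩ := U.mkQ_surjective w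
  have hvU : v ∉ U := fun h => hw0 ((Submodule.Quotient.mk_eq_zero _).2 h)
  have hχ : ∀ h : H, ∃ c : K,
      matrixAction G (Subgroup.inclusion hHG h) v - c • v ∈ U := fun h => by
    obtain ⟨c, hc⟩ := hw h
    refine ⟨c, ?_⟩
    rw [← Submodule.Quotient.mk_eq_zero, Submodule.Quotient.mk_sub, sub_eq_zero]
    exact hc
  choose χ hχ using hχ
  -- Under right translation by `H` the functions in `V` have weight `χ`, and those in `F` are
  -- invariant because `H` centralizes `x`.
  let V : Submodule K (regularFunctions G) := U.dualAnnihilator.map (orbitFunction v)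
  let F : Submodule K (regularFunctions G) := LinearMap.range (conjFunction x)
  have hVrange : V ≤ LinearMap.range (orbitFunction (G := G) v) := LinearMap.map_le_range
  have hV0 : V ≠ ⊥ := by
    intro h
    refine hvU ?_
    rw [← Subspace.dualAnnihilator_dualCoannihilator_eq (W := U), Submodule.mem_dualCoannihilator]
    intro ξ hξ
    have h1 : orbitFunction v ξ ∈ V := Submodule.mem_map_of_mem hξ
    rw [h, Submodule.mem_bot] at h1
    have h2 := congrFun (congrArg Subtype.val h1) (1 : G)
    rw [orbitFunction_apply, map_one] at h2
    exact h2
  have hLV : ∀ g, ∀ f ∈ V, leftTranslation g f ∈ V := by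
    rintro g _ ⟨ξ, hξ, rfl⟩
    rw [leftTranslation_orbitFunction]
    exact Submodule.mem_map_of_mem (comp_mem_dualAnnihilator hU hξ g)
  have hLF : ∀ g, ∀ f ∈ F, leftTranslation g f ∈ F := by
    rintro g _ ⟨A, rfl⟩
    rw [leftTranslation_conjFunction]
    exact ⟨_, rfl⟩
  have hsemiV : ∀ (h : H), ∀ f ∈ V,
      rightTranslation (Subgroup.inclusion hHG h) f = χ h • f := by
    rintro h _ ⟨ξ, hξ, rfl⟩
    exact rightTranslation_orbitFunction hU (hχ h) hξ
  have hsemi : ∀ (h : H), ∀ f ∈ V * F,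
      rightTranslation (Subgroup.inclusion hHG h) f = χ h • f := by
    intro h f hf
    refine Submodule.mul_induction_on hf ?_ fun a b ha hb => by rw [map_add, ha, hb, smul_add]
    rintro a ha _ ⟨A, rfl⟩
    rw [map_mul, hsemiV h a ha, rightTranslation_conjFunction (hH _ h.2), smul_mul_assoc]
  have hconst := exists_algebraMap_eq_of_forall_hyperplane (leftTranslation (G := G)) 1
    leftTranslation_one (V := V) (F := F) ((IsNoetherian.noetherian _).map _)
    (Module.Finite.iff_fg.1 (Module.Finite.range (conjFunction x)))
    ⟨(0, 1), by ext g; rw [conjFunction_apply]; simp⟩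
    hV0 (leftTranslation_mem_iff hLV) (leftTranslation_mem_iff hLF)
    (by
      intro y hy z hz u hu hu0
      -- All of `y`, `z`, `u` have the same weight, so the infinite group `H` fixes `y / u` and `z /
      -- u`.
      refine exists_aeval_div_eq_zero hdim
        (fun h : H => rightTranslation (Subgroup.inclusion hHG h)) ?_ hu0 ?_ ?_
      · intro a b hab
        refine Subgroup.inclusion_injective hHG (regularFunctions_ext fun f => ?_)
        have h := congrArg (fun σ : regularFunctions G ≃ₐ[K] regularFunctions G => (σ f).1 1) hab
        simpa only [rightTranslation_apply, one_mul] using h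
      · intro h
        rw [hsemi h y hy, hsemiV h u hu, smul_mul_assoc, mul_smul_comm]
      · intro h
        rw [hsemi h z hz, hsemiV h u hu, smul_mul_assoc, mul_smul_comm])
    (by
      intro 𝓦 hfin W hWV _ hcov
      exact exists_forall_of_finite_cover hG hfin
        (fun W' => {g : G | ∀ u ∈ W, leftTranslation g u ∈ W'})
        (fun W' _ => isClosed_setOf_leftTranslation_mem v hVrange hWV) hcov)
    (by
      rintro W hWV hW _ ⟨ξ₀, hξ₀, rfl⟩ hξ₀W
      by_contra! hcon
      exact hno (exists_larger_invariant_of_hyperplane hU v hW hξ₀ hξ₀W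
        fun ξ hξ => hcon _ (Submodule.mem_map_of_mem hξ)))
  -- Since `F` contains the entries of `g x g⁻¹`, its being constant makes `x` central.
  refine hg₀ (mul_comm_of_forall_conj_const (fun i j => ?_) g₀)
  obtain ⟨c, hc⟩ := hconst _ ⟨(Matrix.single j i 1, 0), rfl⟩
  refine ⟨c, fun g => ?_⟩
  rw [← conjFunction_single, ← hc]
  rfl

/-- A closed irreducible group of dimension at most two is solvable. -/
theorem isSolvable_of_ringKrullDim_le_two
    (hG : IsIrreducible (G : Set (Matrix.SpecialLinearGroup (Fin n) K)))
    (hGc : IsClosed (G : Set (Matrix.SpecialLinearGroup (Fin n) K)))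
    (hdim : ringKrullDim (regularFunctions G) ≤ 2) : Group.IsSolvable G := by
  have := isDomain_regularFunctions hG
  by_cases hab : ∀ a b : G, a * b = b * a
  · exact Group.isSolvable_of_comm hab
  push Not at hab
  obtain ⟨g₀, x, hx⟩ := hab
  have hninj : ¬ Function.Injective (conjPullback x) := fun h => hx (by
    rw [eq_one_of_injective_conjPullback h g₀, one_mul, mul_one])
  have hinf := infinite_centralizer hGc hdim hninj ⟨g₀, x, hx⟩
  let L := (Subgroup.centralizer {x}).map G.subtype
  have : Infinite L := Infinite.of_injective _
    ((Subgroup.centralizer {x}).equivMapOfInjective G.subtype G.subtype_injective).injective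
  obtain ⟨H, hHL, hHinf, hHirr⟩ := exists_infinite_irreducible_subgroup L
  have hHG : H ≤ G := hHL.trans (Subgroup.map_subtype_le _)
  have hH : ∀ g : G, g.1 ∈ H → g * x = x * g := by
    intro g hg
    obtain ⟨k, hk, hkg⟩ := hHL hg
    rw [← Subtype.ext (a1 := k) (a2 := g) hkg]
    exact Subgroup.mem_centralizer_singleton_iff.1 hk
  have := isDomain_regularFunctions hHirr
  have hcomm := mul_comm_of_le_centralizer hdim hHG hH ⟨g₀, hx⟩
  exact isSolvable_of_invariant_flag (matrixAction G) injective_matrixAction fun U hU hUtop =>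
    exists_larger_invariant hG hdim hHG hcomm hH ⟨g₀, hx⟩ hU hUtop

end Cover

end LinAlgGrp

/-! ### The main theorem -/

theorem mainTheorem11 {K : Type*} [Field K] [IsAlgClosed K] (n : ℕ)
    (G : Subgroup (Matrix.SpecialLinearGroup (Fin n) K))
    (hG : LinAlgGrp.IsLinearAlgebraicGroup G) (hconn : LinAlgGrp.IsZariskiConnected G) :
    (LinAlgGrp.dim (LinAlgGrp.points G) < 3 → Group.IsSolvable G) ∧
      (LinAlgGrp.dim (LinAlgGrp.points G) = 1 → ∀ g h : G, g * h = h * g) := by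
  have hirr := hconn.isIrreducible
  have hle := LinAlgGrp.ringKrullDim_le_dim hirr
  rw [← LinAlgGrp.ringKrullDim_regularFunctions] at hle
  refine ⟨fun h => LinAlgGrp.isSolvable_of_ringKrullDim_le_two hirr hG.isClosed ?_, fun h => ?_⟩
  · exact LinAlgGrp.le_of_lt_add_one (m := 2) (hle.trans_lt (by exact_mod_cast h))
  · have := LinAlgGrp.isDomain_regularFunctions hirr
    exact LinAlgGrp.mul_comm_of_ringKrullDim_le_one (hle.trans h.le)
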